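/- Let $M$ be a closed (compact, without boundary, Hausdorff) smooth manifold of dimension $n\ge 3$. A conformal class on $M$ is a set $[g]=\{e^f g : f\in C^\infty(M)\}$, where $g$ is a smooth pseudo-Riemannian metric on $M$. A projectively parametrized lightlike geodesic of $[g]$ on an open interval $I\subset\mathbf R$ is a curve $\gamma:I\to M$ of the form $\gamma=\xi\circ u^{-1}$, where, for some (equivalently, any) metric $g$ in the class, $\xi:J\to M$ is an affinely parametrized lightlike (possibly constant) geodesic of $g$ on an open interval $J$, and $u:J\to I$ is a smooth bijection with $u'\neq 0$ everywhere and $$\Big(\frac{u''}{u'}\Big)'-\frac12\Big(\frac{u''}{u'}\Big)^2=\frac{2}{n-2}\,\mathrm{Ric}_g(\xi',\xi').$$ The class $[g]$ is totally conformally lightlike incomplete if every projectively parametrized lightlike geodesic $\mathbf R\to M$ is constant. The Markowitz pseudodistance is $$\delta_{[g]}(x,y)=\inf\ \sum_{k=1}^m d_I(s_k,t_k)\in[0,\infty],$$ where $I=(-1,1)$, $d_I$ is the distance of the metric $\frac{4\,dx^2}{(1-x^2)^2}$, and the infimum (equal to $\infty$ over the empty set) runs over all $m\ge1$, all projectively parametrized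 lightlike geodesics $\gamma_1,\dots,\gamma_m:I\to M$ of $[g]$ and all $s_k,t_k\in I$ with $\gamma_1(s_1)=x$, $\gamma_m(t_m)=y$ and $\gamma_k(t_k)=\gamma_{k+1}(s_{k+1})$ for $1\le k<m$. The class $[g]$ is Markowitz hyperbolic if $\delta_{[g]}(x,y)>0$ whenever $x\ne y$. The set $\mathcal C(M)$ of conformal classes on $M$ carries the $C^2$ topology, that is, the quotient of the $C^2$ topology on smooth pseudo-Riemannian metrics. Theorem. If $[g]\in\mathcal C(M)$ is totally conformally lightlike incomplete, then there is a neighborhood $\mathcal W$ of $[g]$ in $\mathcal C(M)$ for the $C^2$ topology such that every $[g']\in\mathcal W$ is Markowitz hyperbolic. In particular, $[g]$ is Markowitz hyperbolic. -/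

import Mathlib

open Set Filter Topology
open scoped Manifold ContDiff Bundle UniformConvergence ENNReal

noncomputable section

namespace ConformalGeometry

/-! ### Pseudo-Riemannian metrics and conformal classes -/

/-- A smooth pseudo-Riemannian metric on an `n`-manifold `M` (of arbitrary signature): a smooth
field of nondegenerate symmetric bilinear forms on the tangent spaces. -/
structure PseudoMetric (n : ℕ) (M : Type*) [TopologicalSpace M]
    [ChartedSpace (EuclideanSpace ℝ (Fin n)) M] [IsManifold (𝓡 n) ∞ M] where
  /-- The bilinear form on each tangent space. -/
  form (x : M) : TangentSpace (𝓡 n) x →L[ℝ] TangentSpace (𝓡 n) x →L[ℝ] ℝ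
  symm (x : M) (v w : TangentSpace (𝓡 n) x) : form x v w = form x w v
  nondegenerate (x : M) (v : TangentSpace (𝓡 n) x) (hv : ∀ w, form x v w = 0) : v = 0
  contMDiff : ContMDiff (𝓡 n)
    ((𝓡 n).prod 𝓘(ℝ, EuclideanSpace ℝ (Fin n) →L[ℝ] EuclideanSpace ℝ (Fin n) →L[ℝ] ℝ)) ∞
    (fun x ↦ Bundle.TotalSpace.mk'
      (EuclideanSpace ℝ (Fin n) →L[ℝ] EuclideanSpace ℝ (Fin n) →L[ℝ] ℝ)
      (E := fun x : M ↦ TangentSpace (𝓡 n) x →L[ℝ] TangentSpace (𝓡 n) x →L[ℝ] ℝ) x (form x))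

variable {n : ℕ} {M : Type*} [TopologicalSpace M]
  [ChartedSpace (EuclideanSpace ℝ (Fin n)) M] [IsManifold (𝓡 n) ∞ M]

/-- Conformal equivalence: `h = e ^ f • g` for some smooth function `f` on `M`. -/
def PseudoMetric.Conformal (g h : PseudoMetric n M) : Prop :=
  ∃ f : M → ℝ, ContMDiff (𝓡 n) 𝓘(ℝ, ℝ) ∞ f ∧
    ∀ (x : M) (v w : TangentSpace (𝓡 n) x), h.form x v w = Real.exp (f x) * g.form x v w

/-- Conformal equivalence is an equivalence relation. -/
def PseudoMetric.conformalSetoid (n : ℕ) (M : Type*) [TopologicalSpace M]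
    [ChartedSpace (EuclideanSpace ℝ (Fin n)) M] [IsManifold (𝓡 n) ∞ M] :
    Setoid (PseudoMetric n M) where
  r := PseudoMetric.Conformal
  iseqv :=
    { refl := fun g ↦ ⟨fun _ ↦ 0, contMDiff_const, fun x v w ↦ by simp⟩
      symm := by
        rintro g h ⟨f, hf, H⟩
        refine ⟨fun x ↦ -f x, hf.neg, fun x v w ↦ ?_⟩
        rw [H, ← mul_assoc, ← Real.exp_add]
        simp
      trans := by
        rintro g h k ⟨f, hf, H⟩ ⟨f', hf', H'⟩
        refine ⟨fun x ↦ f' x + f x, hf'.add hf, fun x v w ↦ ?_⟩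
        rw [H', H, ← mul_assoc, ← Real.exp_add] }

/-- The set of conformal classes `[g]` of pseudo-Riemannian metrics on `M`. -/
def ConformalClass (n : ℕ) (M : Type*) [TopologicalSpace M]
    [ChartedSpace (EuclideanSpace ℝ (Fin n)) M] [IsManifold (𝓡 n) ∞ M] : Type _ :=
  Quotient (PseudoMetric.conformalSetoid n M)

/-- The conformal class `[g]` of a metric `g`. -/
def PseudoMetric.conformalClass (g : PseudoMetric n M) : ConformalClass n M :=
  Quotient.mk (PseudoMetric.conformalSetoid n M) g

/-! ### Local coordinates -/

/-- The standard basis vector `e i` of `ℝⁿ`. -/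
def basisVec (i : Fin n) : EuclideanSpace ℝ (Fin n) := EuclideanSpace.single i 1

/-- Partial derivative `∂ᵢ f` of a function on `ℝⁿ`. -/
def partialDeriv (i : Fin n) (f : EuclideanSpace ℝ (Fin n) → ℝ) (y : EuclideanSpace ℝ (Fin n)) :
    ℝ :=
  fderiv ℝ f y (basisVec i)

/-- The tangent vector at the point with coordinates `y` in the chart at `x₀` whose coordinates are
`v`, that is, the image of `v` under the differential of the inverse of the chart. -/
def chartVector {E : Type*} [NormedAddCommGroup E] [NormedSpace ℝ E] {M : Type*}
    [TopologicalSpace M] [ChartedSpace E M] (x₀ : M) (y v : E) :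
    TangentSpace 𝓘(ℝ, E) ((extChartAt 𝓘(ℝ, E) x₀).symm y) :=
  mfderiv 𝓘(ℝ, E) 𝓘(ℝ, E) (extChartAt 𝓘(ℝ, E) x₀).symm y v

/-- The matrix `(gᵢⱼ)` of `g` in the chart at `x₀`: `gᵢⱼ(y) = g(∂ᵢ, ∂ⱼ)` where `∂ᵢ` is the
`i`-th coordinate vector field of that chart. It is meaningful for `y` in the chart's target. -/
def PseudoMetric.coord (g : PseudoMetric n M) (x₀ : M) (y : EuclideanSpace ℝ (Fin n)) :
    Matrix (Fin n) (Fin n) ℝ :=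
  Matrix.of fun i j ↦
    g.form ((extChartAt (𝓡 n) x₀).symm y)
      (chartVector x₀ y (basisVec i)) (chartVector x₀ y (basisVec j))

/-- Christoffel symbols `Γᵏᵢⱼ = ½ gᵏˡ (∂ᵢ gⱼₗ + ∂ⱼ gᵢₗ - ∂ₗ gᵢⱼ)` of the Levi-Civita connection. -/
def christoffel (G : EuclideanSpace ℝ (Fin n) → Matrix (Fin n) (Fin n) ℝ) (k i j : Fin n)
    (y : EuclideanSpace ℝ (Fin n)) : ℝ :=
  (1 / 2) * ∑ l, (G y)⁻¹ k l *
    (partialDeriv i (fun z ↦ G z j l) y + partialDeriv j (fun z ↦ G z i l) y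
      - partialDeriv l (fun z ↦ G z i j) y)

/-- Components of the Ricci tensor:
`Rᵢⱼ = ∂ₖ Γᵏᵢⱼ - ∂ⱼ Γᵏᵢₖ + Γᵏₖₗ Γˡᵢⱼ - Γᵏⱼₗ Γˡᵢₖ` (positive on round spheres). -/
def ricci (G : EuclideanSpace ℝ (Fin n) → Matrix (Fin n) (Fin n) ℝ) (i j : Fin n)
    (y : EuclideanSpace ℝ (Fin n)) : ℝ :=
  (∑ k, (partialDeriv k (christoffel G k i j) y - partialDeriv j (christoffel G k i k) y))
    + ∑ k, ∑ l, (christoffel G k k l y * christoffel G l i j y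
      - christoffel G k j l y * christoffel G l i k y)

/-- The curve `ξ` read in the chart at `x₀`. -/
def coordCurve (n : ℕ) {M : Type*} [TopologicalSpace M]
    [ChartedSpace (EuclideanSpace ℝ (Fin n)) M] (x₀ : M) (ξ : ℝ → M) (t : ℝ) :
    EuclideanSpace ℝ (Fin n) :=
  extChartAt (𝓡 n) x₀ (ξ t)

/-! ### Projectively parametrized lightlike geodesics -/

/-- `ξ`, restricted to the open set `J ⊆ ℝ`, is a lightlike affinely parametrized geodesic of `g`:
it is smooth and, in every chart, `g(ξ', ξ') = 0` and `ξ''ᵏ + Γᵏᵢⱼ ξ'ⁱ ξ'ʲ = 0`.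
Constant curves are included. -/
def IsLightlikeGeodesicOn (g : PseudoMetric n M) (ξ : ℝ → M) (J : Set ℝ) : Prop :=
  ContMDiffOn 𝓘(ℝ, ℝ) (𝓡 n) ∞ ξ J ∧
  ∀ x₀ : M, ∀ t ∈ J, ξ t ∈ (extChartAt (𝓡 n) x₀).source →
    (∑ i, ∑ j, g.coord x₀ (coordCurve n x₀ ξ t) i j *
        deriv (coordCurve n x₀ ξ) t i * deriv (coordCurve n x₀ ξ) t j = 0) ∧
    ∀ k, deriv (deriv (coordCurve n x₀ ξ)) t k +
      ∑ i, ∑ j, christoffel (g.coord x₀) k i j (coordCurve n x₀ ξ t) *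
        deriv (coordCurve n x₀ ξ) t i * deriv (coordCurve n x₀ ξ) t j = 0

/-- The Schwarzian derivative `S u = (u'' / u')' - ½ (u'' / u')²`. -/
def schwarzian (u : ℝ → ℝ) (t : ℝ) : ℝ :=
  deriv (fun s ↦ deriv (deriv u) s / deriv u s) t - (1 / 2) * (deriv (deriv u) t / deriv u t) ^ 2

/-- `u` is a projective parameter along the geodesic `ξ` on the open set `J`: a smooth function
with nowhere vanishing derivative such that `S u = 2 / (n - 2) * Ric(ξ', ξ')`, the right-hand side
being computed in any chart. -/
def IsProjectiveParameterOn (g : PseudoMetric n M) (ξ : ℝ → M) (u : ℝ → ℝ) (J : Set ℝ) : Prop :=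
  ContDiffOn ℝ ∞ u J ∧ (∀ t ∈ J, deriv u t ≠ 0) ∧
  ∀ x₀ : M, ∀ t ∈ J, ξ t ∈ (extChartAt (𝓡 n) x₀).source →
    schwarzian u t = 2 / ((n : ℝ) - 2) *
      ∑ i, ∑ j, ricci (g.coord x₀) i j (coordCurve n x₀ ξ t) *
        deriv (coordCurve n x₀ ξ) t i * deriv (coordCurve n x₀ ξ) t j

/-- For an open interval `I`, the restriction of `γ` to `I` has the form `ξ ∘ u⁻¹`, where `ξ` is a
lightlike affine geodesic of `g` defined on an open interval `J` and `u : J → I` is a bijective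
projective parameter along `ξ`. -/
def PseudoMetric.IsPPL (g : PseudoMetric n M) (I : Set ℝ) (γ : ℝ → M) : Prop :=
  ∃ (J : Set ℝ) (ξ : ℝ → M) (u : ℝ → ℝ), IsOpen J ∧ J.OrdConnected ∧
    IsLightlikeGeodesicOn g ξ J ∧ IsProjectiveParameterOn g ξ u J ∧ BijOn u J I ∧
    ∀ t ∈ J, γ (u t) = ξ t

/-- `γ : I → M` is a projectively parametrized lightlike geodesic of the conformal class `c`, that
is, of some metric in `c`. (The values of `γ` outside of the open interval `I` are irrelevant.) -/
def ConformalClass.IsPPL (c : ConformalClass n M) (I : Set ℝ) (γ : ℝ → M) : Prop :=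
  ∃ g : PseudoMetric n M, g.conformalClass = c ∧ g.IsPPL I γ

/-- `(M, c)` is totally conformally lightlike incomplete: every projectively parametrized lightlike
geodesic `ℝ → M` is constant. -/
def ConformalClass.TotallyLightlikeIncomplete (c : ConformalClass n M) : Prop :=
  ∀ γ : ℝ → M, c.IsPPL univ γ → ∃ x : M, ∀ t, γ t = x

/-! ### The Markowitz pseudodistance -/

/-- The distance on `(-1, 1)` of the Riemannian metric `4 dx² / (1 - x²)²`; note that
`2 artanh` is a primitive of `2 / (1 - x²)`. -/
def poincareDist (s t : ℝ) : ℝ := 2 * |Real.artanh t - Real.artanh s|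

/-- A lightlike chain from `x` to `y`, made of `m + 1` projectively parametrized lightlike
geodesics `γ k : (-1, 1) → M` with marked parameters `s k`, `t k`. -/
structure LightlikeChain (c : ConformalClass n M) (x y : M) where
  m : ℕ
  γ : Fin (m + 1) → ℝ → M
  s : Fin (m + 1) → ℝ
  t : Fin (m + 1) → ℝ
  isPPL : ∀ k, c.IsPPL (Ioo (-1) 1) (γ k)
  s_mem : ∀ k, s k ∈ Ioo (-1 : ℝ) 1
  t_mem : ∀ k, t k ∈ Ioo (-1 : ℝ) 1
  start : γ 0 (s 0) = x
  finish : γ (Fin.last m) (t (Fin.last m)) = y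
  link : ∀ k : Fin m, γ k.castSucc (t k.castSucc) = γ k.succ (s k.succ)

/-- The length of a lightlike chain. -/
def LightlikeChain.length {c : ConformalClass n M} {x y : M} (C : LightlikeChain c x y) : ℝ :=
  ∑ k, poincareDist (C.s k) (C.t k)

/-- The Markowitz pseudodistance: the infimum of the lengths of the lightlike chains from `x` to
`y` (with value `∞` if there is none). -/
def ConformalClass.markowitzDist (c : ConformalClass n M) (x y : M) : ℝ≥0∞ :=
  ⨅ C : LightlikeChain c x y, ENNReal.ofReal C.length

/-- `(M, c)` is Markowitz hyperbolic: its Markowitz pseudodistance separates points. -/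
def ConformalClass.MarkowitzHyperbolic (c : ConformalClass n M) : Prop :=
  ∀ x y : M, x ≠ y → 0 < c.markowitzDist x y

/-! ### The `C²` topology -/

/-- The `C²` topology on metrics: uniform convergence, on the compact subsets of the charts, of the
components `gᵢⱼ` together with their derivatives of order at most two. -/
instance PseudoMetric.c2Topology : TopologicalSpace (PseudoMetric n M) :=
  ⨅ (x₀ : M) (i : Fin n) (j : Fin n) (k : Fin 3),
    TopologicalSpace.induced
      (fun g ↦ UniformOnFun.ofFun {K | IsCompact K ∧ K ⊆ (extChartAt (𝓡 n) x₀).target}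
        (iteratedFDeriv ℝ (k : ℕ) (fun y ↦ g.coord x₀ y i j)))
      inferInstance

/-- The `C²` topology on conformal classes: the quotient of the `C²` topology on metrics. -/
instance ConformalClass.c2Topology : TopologicalSpace (ConformalClass n M) :=
  inferInstanceAs (TopologicalSpace (Quotient (PseudoMetric.conformalSetoid n M)))

end ConformalGeometry

end

/-! This is Brody's rescaling argument, transposed from complex hyperbolicity to lightlike
geodesics. Embed `M` in some `ℝᴺ` by `e` and measure speeds there. The central property is
`SpeedBound e g C`: every projectively parametrized lightlike geodesic on `(-1, 1)` has speed at
most `C` at `0`. Affine changes of parameter preserve projective parametrizations, so the bound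
gives `‖(e ∘ γ)' s‖ * (1 - |s|) ≤ C`. Thus `e ∘ γ` is `C`-Lipschitz for the Poincaré distance, and
summing along a chain bounds the Markowitz pseudodistance of `x` and `y` below by `‖e y - e x‖ / C`
(`SpeedBound.markowitzHyperbolic`). On the whole line the same scaling forces the speed to vanish
(`SpeedBound.totallyLightlikeIncomplete`).

Conversely, incompleteness of `[g]` gives one bound valid for all metrics `C²`-close to `g`
(`exists_speedBound`). Otherwise some metrics tending to `g` carry geodesics whose speed at `0`
tends to infinity. Recentring and rescaling them (`exists_almost_max`, `exists_rescaled_geodesic`)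
makes the speeds at most `2` on intervals exhausting `ℝ`, and equal to `1` at `0`. A limit is a
nonconstant projectively parametrized geodesic of `g` on `ℝ`, which is excluded.

The existence of the limit is the delicate point, since a bound on the speed does not by itself
bound the acceleration. Writing `γ'' + Γ(γ', γ') = φ γ'`, the projective condition becomes the
Riccati equation `φ' = φ² / 2 - 2 / (n - 2) * Ric(γ', γ')` (`ProjGeodesicOn`). When `Ric(γ', γ')` is
bounded, a large value of `|φ|` forces blow-up in short time, forwards or backwards; so
`riccati_bound` controls `φ`, and with it all derivatives that matter. The limit solves the limit
system because `C²` convergence of metrics carries the Ricci tensors along. Finally,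
`ProjGeodesicOn.conformal` allows a single metric to represent its class. -/

noncomputable section

namespace ConformalGeometry

/-! ### Analysis on the real line -/

section Analysis

variable {F : Type*} [NormedAddCommGroup F] [NormedSpace ℝ F]

/-- A solution of an autonomous differential equation with smooth right-hand side is smooth. -/
theorem contDiffOn_of_hasDerivAt_autonomous {X : F → F} {Ω : Set F} {z : ℝ → F} {U : Set ℝ}
    (hU : IsOpen U) (hX : ContDiffOn ℝ ∞ X Ω) (hz : MapsTo z U Ω)
    (h : ∀ t ∈ U, HasDerivAt z (X (z t)) t) : ContDiffOn ℝ ∞ z U := by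
  rw [contDiffOn_infty]
  intro m
  induction m with
  | zero =>
    exact contDiffOn_zero.2 fun t ht ↦ (h t ht).continuousAt.continuousWithinAt
  | succ m ih =>
    rw [Nat.cast_succ, contDiffOn_succ_iff_deriv_of_isOpen hU]
    refine ⟨fun t ht ↦ (h t ht).differentiableAt.differentiableWithinAt, by simp, ?_⟩
    exact ((contDiffOn_infty.1 hX m).comp ih hz).congr fun t ht ↦ (h t ht).deriv

/-- The inverse of a bijection between open sets of the line with nonvanishing derivative. -/
theorem hasDerivAt_of_bijOn {u τ : ℝ → ℝ} {J I : Set ℝ} (hJ : IsOpen J)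
    (hu : ContDiffOn ℝ ∞ u J) (hu' : ∀ t ∈ J, deriv u t ≠ 0) (hτ : ∀ s ∈ I, τ s ∈ J)
    (hτu : ∀ t ∈ J, τ (u t) = t) (huτ : ∀ s ∈ I, u (τ s) = s) {s : ℝ} (hs : s ∈ I) :
    HasDerivAt τ (deriv u (τ s))⁻¹ s := by
  have ht := hτ s hs
  have h1 : ContDiffAt ℝ ∞ u (τ s) := hu.contDiffAt (hJ.mem_nhds ht)
  have h2 := h1.hasStrictDerivAt (by simp)
  have h3 := h2.to_local_left_inverse (g := τ) (hu' _ ht)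
    (by filter_upwards [hJ.mem_nhds ht] with x hx using hτu x hx)
  rw [huτ s hs] at h3
  exact h3.hasDerivAt

/-- The inverse solves the autonomous equation `τ' = 1 / u'(τ)`, whose right-hand side is smooth. -/
theorem contDiffOn_of_bijOn {u τ : ℝ → ℝ} {J I : Set ℝ} (hJ : IsOpen J) (hI : IsOpen I)
    (hu : ContDiffOn ℝ ∞ u J) (hu' : ∀ t ∈ J, deriv u t ≠ 0) (hτ : ∀ s ∈ I, τ s ∈ J)
    (hτu : ∀ t ∈ J, τ (u t) = t) (huτ : ∀ s ∈ I, u (τ s) = s) :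
    ContDiffOn ℝ ∞ τ I :=
  contDiffOn_of_hasDerivAt_autonomous (X := fun t ↦ (deriv u t)⁻¹) hI
    (((contDiffOn_infty_iff_deriv_of_isOpen hJ).1 hu).2.inv hu') hτ
    fun _ hs ↦ hasDerivAt_of_bijOn hJ hu hu' hτ hτu huτ hs

variable {ι : Type*} {l : Filter ι}

/-- A locally equi-Lipschitz family which converges at a point converges continuously there. -/
theorem tendsto_prod_nhds_of_deriv_bounded {f f' : ι → ℝ → F} {t C : ℝ} {L : F}
    (hf : ∀ᶠ p : ι × ℝ in l ×ˢ 𝓝 t, HasDerivAt (f p.1) (f' p.1 p.2) p.2)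
    (hC : ∀ᶠ p : ι × ℝ in l ×ˢ 𝓝 t, ‖f' p.1 p.2‖ ≤ C)
    (hL : Tendsto (fun k ↦ f k t) l (𝓝 L)) :
    Tendsto (fun p : ι × ℝ ↦ f p.1 p.2) (l ×ˢ 𝓝 t) (𝓝 L) := by
  obtain ⟨A, hA, B, hB, hAB⟩ := eventually_prod_iff.1 (hf.and hC)
  obtain ⟨δ, hδ, hball⟩ := Metric.eventually_nhds_iff_ball.1 hB
  have key : ∀ᶠ p : ι × ℝ in l ×ˢ 𝓝 t, ‖f p.1 p.2 - f p.1 t‖ ≤ C * ‖p.2 - t‖ := by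
    filter_upwards [hA.prod_mk (Metric.ball_mem_nhds t hδ)] with p hp
    refine (convex_ball t δ).norm_image_sub_le_of_norm_hasDerivWithin_le (f' := f' p.1)
      (fun x hx ↦ ((hAB hp.1 (hball x hx)).1).hasDerivWithinAt)
      (fun x hx ↦ (hAB hp.1 (hball x hx)).2) (Metric.mem_ball_self hδ) hp.2
  have h0 : Tendsto (fun p : ι × ℝ ↦ f p.1 p.2 - f p.1 t) (l ×ˢ 𝓝 t) (𝓝 0) := by
    refine squeeze_zero_norm' key ?_
    have : Tendsto (fun x : ℝ ↦ C * ‖x - t‖) (𝓝 t) (𝓝 (C * ‖t - t‖)) :=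
      (Continuous.tendsto (by fun_prop) t)
    simpa [Function.comp_def] using this.comp tendsto_snd
  simpa using h0.add (hL.comp tendsto_fst)

/-- Passing to the limit in a family of derivatives. -/
theorem hasDerivAt_of_tendsto_prod_nhds [NeBot l] {f f' : ι → ℝ → F} {g : ℝ → F} {t : ℝ} {L : F}
    (hf : ∀ᶠ p : ι × ℝ in l ×ˢ 𝓝 t, HasDerivAt (f p.1) (f' p.1 p.2) p.2)
    (hf' : Tendsto (fun p : ι × ℝ ↦ f' p.1 p.2) (l ×ˢ 𝓝 t) (𝓝 L))
    (hg : ∀ᶠ s in 𝓝 t, Tendsto (fun k ↦ f k s) l (𝓝 (g s))) : HasDerivAt g L t := by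
  refine hasDerivAt_of_tendstoUniformlyOnFilter (l := l) (f := f) (f' := f') (g' := fun _ ↦ L)
    ?_ hf hg
  rw [Metric.tendstoUniformlyOnFilter_iff]
  intro ε hε
  filter_upwards [Metric.tendsto_nhds.1 hf' ε hε] with p hp
  rwa [dist_comm]

/-- One-sided bound for solutions of a Riccati differential inequality. -/
theorem riccati_upper_bound {φ φ' : ℝ → ℝ} {s δ A B : ℝ} (hδ : 0 < δ) (hB : 4 ≤ B * δ)
    (hA : 4 * A < B ^ 2) (hφ : ∀ x ∈ Icc s (s + δ), HasDerivAt φ (φ' x) x)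
    (h : ∀ x ∈ Icc s (s + δ), φ x ^ 2 / 2 - A ≤ φ' x) : φ s < B := by
  -- If `φ s ≥ B`, then `φ` stays above `B` and satisfies `φ' ≥ φ² / 4`. Hence `1 / φ` decreases at
  -- rate at least `1 / 4` from a value at most `1 / B ≤ δ / 4`, and cannot be positive at `s + δ`.
  by_contra! hs
  have hB0 : 0 < B := by
    by_contra! hB0
    nlinarith
  -- Barrier argument: at a point where `φ = B`, `φ' ≥ B² / 2 - A > B² / 4 > 0`.
  have low : ∀ x ∈ Icc s (s + δ), B ≤ φ x := by
    have := image_le_of_deriv_right_lt_deriv_boundary (f := fun x ↦ -φ x) (f' := fun x ↦ -φ' x)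
      (a := s) (b := s + δ) (B := fun _ ↦ -B) (B' := fun _ ↦ 0)
      (fun x hx ↦ (hφ x hx).continuousAt.neg.continuousWithinAt)
      (fun x hx ↦ (hφ x (Ico_subset_Icc_self hx)).neg.hasDerivWithinAt) (by simpa using hs)
      (fun x ↦ hasDerivAt_const _ _) (fun x hx hx' ↦ by
        have h1 := h x (Ico_subset_Icc_self hx)
        have h2 : φ x = B := by linarith
        rw [h2] at h1
        nlinarith)
    intro x hx
    have := this hx
    linarith
  have hpos : ∀ x ∈ Icc s (s + δ), 0 < φ x := fun x hx ↦ hB0.trans_le (low x hx)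
  have mono : MonotoneOn (fun x ↦ -(φ x)⁻¹ - x / 4) (Icc s (s + δ)) := by
    have hd : ∀ x ∈ Icc s (s + δ),
        HasDerivAt (fun x ↦ -(φ x)⁻¹ - x / 4) (-(-φ' x / φ x ^ 2) - 1 / 4) x := fun x hx ↦
      ((hφ x hx).inv (hpos x hx).ne').neg.sub ((hasDerivAt_id x).div_const 4)
    refine monotoneOn_of_hasDerivWithinAt_nonneg (convex_Icc _ _)
      (fun x hx ↦ (hd x hx).continuousAt.continuousWithinAt)
      (fun x hx ↦ (hd x (interior_subset hx)).hasDerivWithinAt) fun x hx ↦ ?_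
    have hx := interior_subset hx
    have h1 := h x hx
    have h2 := low x hx
    have h3 : φ x ^ 2 / 4 ≤ φ' x := by nlinarith
    have h4 : 1 / 4 ≤ φ' x / φ x ^ 2 := by
      rw [le_div_iff₀ (pow_pos (hpos x hx) 2)]
      linarith
    rw [neg_div, neg_neg]
    linarith
  have h1 := mono (left_mem_Icc.2 (by linarith)) (right_mem_Icc.2 (by linarith))
    (by linarith : s ≤ s + δ)
  have h2 : 0 < (φ (s + δ))⁻¹ := inv_pos.2 (hpos _ (right_mem_Icc.2 (by linarith)))
  have h3 : (φ s)⁻¹ ≤ B⁻¹ := inv_anti₀ hB0 hs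
  have h4 : B⁻¹ ≤ δ / 4 := by
    rw [inv_le_iff_one_le_mul₀ hB0]
    linarith
  simp only at h1
  linarith

/-- Two-sided bound for solutions of a Riccati differential inequality. -/
theorem riccati_bound {φ φ' : ℝ → ℝ} {s δ A B : ℝ} (hδ : 0 < δ) (hB : 4 ≤ B * δ)
    (hA : 4 * A < B ^ 2) (hφ : ∀ x ∈ Icc (s - δ) (s + δ), HasDerivAt φ (φ' x) x)
    (h : ∀ x ∈ Icc (s - δ) (s + δ), φ x ^ 2 / 2 - A ≤ φ' x) : |φ s| ≤ B := by
  have sub1 : Icc s (s + δ) ⊆ Icc (s - δ) (s + δ) := Icc_subset_Icc (by linarith) le_rfl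
  have h1 := riccati_upper_bound hδ hB hA (fun x hx ↦ hφ x (sub1 hx)) fun x hx ↦ h x (sub1 hx)
  -- The inequality is invariant under time reversal `φ ↦ -φ(-·)`, which turns the upper bound into
  -- the lower one.
  have sub2 : ∀ x ∈ Icc (-s) (-s + δ), -x ∈ Icc (s - δ) (s + δ) := fun x hx ↦
    ⟨by linarith [hx.2], by linarith [hx.1]⟩
  have h2 := riccati_upper_bound (φ := fun x ↦ -φ (-x)) (φ' := fun x ↦ φ' (-x)) (s := -s) hδ hB hA
    (fun x hx ↦ by
      have := ((hφ _ (sub2 x hx)).comp x (hasDerivAt_neg x)).neg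
      simpa [Function.comp_def, Pi.neg_def] using this)
    fun x hx ↦ by simpa using h _ (sub2 x hx)
  rw [neg_neg] at h2
  exact abs_le.2 ⟨by linarith, h1.le⟩

/-- A point at which a function is large and, at the corresponding scale, almost maximal. -/
theorem exists_almost_max {f : ℝ → ℝ} {ρ : ℝ} (hρ : 0 < ρ) (hf : ContinuousOn f (Icc (-ρ) ρ))
    (hf0 : 0 < f 0) : ∃ s₀ ∈ Ioo (-ρ) ρ, f 0 * ρ ≤ f s₀ * (ρ - |s₀|) ∧ 0 < f s₀ ∧
      ∀ s, |s - s₀| ≤ (ρ - |s₀|) / 2 → f s ≤ 2 * f s₀ := by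
  -- The weight `ρ - |s|` keeps the maximum away from the ends. Within distance `(ρ - |s₀|) / 2` of
  -- `s₀` it drops at most by half, whence the factor `2`.
  obtain ⟨s₀, hs₀, hmax⟩ := isCompact_Icc.exists_isMaxOn (f := fun s ↦ f s * (ρ - |s|))
    ⟨0, by constructor <;> linarith⟩ (hf.mul (by fun_prop))
  have h0 : f 0 * ρ ≤ f s₀ * (ρ - |s₀|) := by
    simpa using hmax (show (0 : ℝ) ∈ Icc (-ρ) ρ by constructor <;> linarith)
  have habs : |s₀| ≤ ρ := abs_le.2 hs₀
  have hpos : 0 < f s₀ * (ρ - |s₀|) := (mul_pos hf0 hρ).trans_le h0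
  have hr : 0 < ρ - |s₀| := by
    rcases eq_or_lt_of_le (sub_nonneg.2 habs) with h | h
    · rw [← h] at hpos
      simp at hpos
    · exact h
  have hfs : 0 < f s₀ := pos_of_mul_pos_left hpos hr.le
  refine ⟨s₀, abs_lt.1 (by linarith), h0, hfs, fun s hs ↦ ?_⟩
  have h1 : |s| ≤ |s₀| + (ρ - |s₀|) / 2 := by
    have := abs_sub_abs_le_abs_sub s s₀
    linarith
  have h2 := hmax (show s ∈ Icc (-ρ) ρ from abs_le.1 (by linarith))
  have h2 : f s * (ρ - |s|) ≤ f s₀ * (ρ - |s₀|) := h2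
  by_contra! h3
  have h4 : f s * ((ρ - |s₀|) / 2) ≤ f s * (ρ - |s|) :=
    mul_le_mul_of_nonneg_left (by linarith) (by linarith)
  nlinarith

theorem hasDerivAt_tanh (x : ℝ) : HasDerivAt Real.tanh (1 - Real.tanh x ^ 2) x := by
  have hc := (Real.cosh_pos x).ne'
  have h := (Real.hasDerivAt_sinh x).div (Real.hasDerivAt_cosh x) hc
  have he : Real.tanh = fun x ↦ Real.sinh x / Real.cosh x := funext Real.tanh_eq_sinh_div_cosh
  rw [he]
  convert! h using 1
  simp only []
  field_simp

/-- Functions with derivative bounded by `K / (1 - |s|)` are Lipschitz for the Poincaré metric. -/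
theorem norm_sub_le_poincareDist {f f' : ℝ → F} {K : ℝ} (hK : 0 ≤ K)
    (hf : ∀ s ∈ Ioo (-1 : ℝ) 1, HasDerivAt f (f' s) s)
    (hf' : ∀ s ∈ Ioo (-1 : ℝ) 1, ‖f' s‖ * (1 - |s|) ≤ K) {s t : ℝ} (hs : s ∈ Ioo (-1 : ℝ) 1)
    (ht : t ∈ Ioo (-1 : ℝ) 1) : ‖f t - f s‖ ≤ K * poincareDist s t := by
  have hmem (x : ℝ) : Real.tanh x ∈ Ioo (-1 : ℝ) 1 := ⟨Real.neg_one_lt_tanh x, Real.tanh_lt_one x⟩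
  -- In the coordinate `x = artanh s` the derivative is multiplied by `1 - s² = (1 - |s|) * (1 +
  -- |s|) ≤ 2 * (1 - |s|)`. The resulting factor `2` is the one in `poincareDist`.
  have key := convex_univ.norm_image_sub_le_of_norm_hasDerivWithin_le (C := 2 * K)
    (f := fun x ↦ f (Real.tanh x)) (f' := fun x ↦ (1 - Real.tanh x ^ 2) • f' (Real.tanh x))
    (x := Real.artanh s) (y := Real.artanh t)
    (fun x _ ↦ ((hf _ (hmem x)).scomp x (hasDerivAt_tanh x)).hasDerivWithinAt)
    (fun x _ ↦ by
      have h1 := hf' _ (hmem x)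
      have h2 := abs_lt.2 (hmem x)
      rw [norm_smul, Real.norm_eq_abs, abs_of_nonneg (by
        nlinarith [sq_abs (Real.tanh x), abs_nonneg (Real.tanh x)]), ← sq_abs]
      have h3 : 0 ≤ |Real.tanh x| := abs_nonneg _
      nlinarith [norm_nonneg (f' (Real.tanh x))]) (mem_univ _) (mem_univ _)
  simp only [Real.tanh_artanh hs, Real.tanh_artanh ht] at key
  rw [poincareDist]
  rw [Real.norm_eq_abs] at key
  linarith

end Analysis

/-! ### Metrics in coordinates -/

section Coordinates

variable {n : ℕ}

theorem sum_smul_basisVec (v : EuclideanSpace ℝ (Fin n)) : ∑ i, v i • basisVec i = v := by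
  ext j
  simp [basisVec, Finset.sum_apply, Pi.single_apply]

theorem contDiffOn_partialDeriv {f : EuclideanSpace ℝ (Fin n) → ℝ}
    {Ω : Set (EuclideanSpace ℝ (Fin n))} (hΩ : IsOpen Ω) (hf : ContDiffOn ℝ ∞ f Ω) (i : Fin n) :
    ContDiffOn ℝ ∞ (partialDeriv i f) Ω :=
  (hf.fderiv_of_isOpen hΩ (by simp)).clm_apply contDiffOn_const

theorem partialDeriv_congr {f g : EuclideanSpace ℝ (Fin n) → ℝ} {y : EuclideanSpace ℝ (Fin n)}
    (h : f =ᶠ[𝓝 y] g) (i : Fin n) : partialDeriv i f y = partialDeriv i g y := by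
  rw [partialDeriv, partialDeriv, h.fderiv_eq]

section Rules

variable {f g : EuclideanSpace ℝ (Fin n) → ℝ} {y : EuclideanSpace ℝ (Fin n)}

theorem partialDeriv_const (c : ℝ) (i : Fin n) : partialDeriv i (fun _ ↦ c) y = 0 := by
  simp [partialDeriv]

theorem partialDeriv_add (hf : DifferentiableAt ℝ f y) (hg : DifferentiableAt ℝ g y) (i : Fin n) :
    partialDeriv i (fun z ↦ f z + g z) y = partialDeriv i f y + partialDeriv i g y := by
  simp only [partialDeriv]
  rw [(hf.hasFDerivAt.fun_add hg.hasFDerivAt).fderiv]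
  rfl

theorem partialDeriv_sub (hf : DifferentiableAt ℝ f y) (hg : DifferentiableAt ℝ g y) (i : Fin n) :
    partialDeriv i (fun z ↦ f z - g z) y = partialDeriv i f y - partialDeriv i g y := by
  simp only [partialDeriv]
  rw [(hf.hasFDerivAt.fun_sub hg.hasFDerivAt).fderiv]
  rfl

theorem partialDeriv_mul (hf : DifferentiableAt ℝ f y) (hg : DifferentiableAt ℝ g y) (i : Fin n) :
    partialDeriv i (fun z ↦ f z * g z) y = partialDeriv i f y * g y + f y * partialDeriv i g y := by
  simp only [partialDeriv]
  rw [(hf.hasFDerivAt.fun_mul hg.hasFDerivAt).fderiv]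
  simp
  ring

theorem partialDeriv_const_mul (c : ℝ) (hf : DifferentiableAt ℝ f y) (i : Fin n) :
    partialDeriv i (fun z ↦ c * f z) y = c * partialDeriv i f y := by
  rw [partialDeriv_mul (differentiableAt_const c) hf, partialDeriv_const]
  ring

theorem partialDeriv_sum {α : Type*} (s : Finset α) {f : α → EuclideanSpace ℝ (Fin n) → ℝ}
    (hf : ∀ a ∈ s, DifferentiableAt ℝ (f a) y) (i : Fin n) :
    partialDeriv i (fun z ↦ ∑ a ∈ s, f a z) y = ∑ a ∈ s, partialDeriv i (f a) y := by
  simp only [partialDeriv]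
  rw [(HasFDerivAt.fun_sum fun a ha ↦ (hf a ha).hasFDerivAt).fderiv]
  simp

theorem partialDeriv_exp (hf : DifferentiableAt ℝ f y) (i : Fin n) :
    partialDeriv i (fun z ↦ Real.exp (f z)) y = Real.exp (f y) * partialDeriv i f y := by
  simp only [partialDeriv]
  rw [hf.hasFDerivAt.exp.fderiv]
  simp

/-- The chain rule along a curve, in terms of partial derivatives. -/
theorem hasDerivAt_comp_curve {c : ℝ → EuclideanSpace ℝ (Fin n)} {c' : EuclideanSpace ℝ (Fin n)}
    {t : ℝ} (hf : DifferentiableAt ℝ f (c t)) (hc : HasDerivAt c c' t) :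
    HasDerivAt (fun s ↦ f (c s)) (∑ i, partialDeriv i f (c t) * c' i) t := by
  have h := hf.hasFDerivAt.comp_hasDerivAt t hc
  convert! h using 1
  conv_rhs => rw [← sum_smul_basisVec c']
  rw [map_sum]
  refine Finset.sum_congr rfl fun i _ ↦ ?_
  rw [map_smul, smul_eq_mul, mul_comm]
  rfl

end Rules

/-- A smooth field of nondegenerate symmetric matrices on an open set of `ℝⁿ`. -/
structure SmoothMetricOn (G : EuclideanSpace ℝ (Fin n) → Matrix (Fin n) (Fin n) ℝ)
    (Ω : Set (EuclideanSpace ℝ (Fin n))) : Prop where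
  isOpen : IsOpen Ω
  contDiffOn (i j : Fin n) : ContDiffOn ℝ ∞ (fun y ↦ G y i j) Ω
  det_ne {y : EuclideanSpace ℝ (Fin n)} (hy : y ∈ Ω) : (G y).det ≠ 0
  symm {y : EuclideanSpace ℝ (Fin n)} (hy : y ∈ Ω) (i j : Fin n) : G y i j = G y j i

theorem contDiffOn_det {G : EuclideanSpace ℝ (Fin n) → Matrix (Fin n) (Fin n) ℝ}
    {Ω : Set (EuclideanSpace ℝ (Fin n))} (h : ∀ i j, ContDiffOn ℝ ∞ (fun y ↦ G y i j) Ω) :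
    ContDiffOn ℝ ∞ (fun y ↦ (G y).det) Ω := by
  simp only [Matrix.det_apply']
  exact ContDiffOn.sum fun σ _ ↦ contDiffOn_const.mul (contDiffOn_prod fun i _ ↦ h _ _)

namespace SmoothMetricOn

variable {G : EuclideanSpace ℝ (Fin n) → Matrix (Fin n) (Fin n) ℝ}
  {Ω : Set (EuclideanSpace ℝ (Fin n))} (hG : SmoothMetricOn G Ω)
include hG

theorem contDiffOn_inv (i j : Fin n) : ContDiffOn ℝ ∞ (fun y ↦ (G y)⁻¹ i j) Ω := by
  simp only [Matrix.inv_def, Matrix.smul_apply, Ring.inverse_eq_inv', smul_eq_mul,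
    Matrix.adjugate_apply]
  refine ((contDiffOn_det hG.contDiffOn).inv fun y hy ↦ hG.det_ne hy).mul
    (contDiffOn_det fun a b ↦ ?_)
  by_cases hab : a = j
  · subst hab
    simpa using contDiffOn_const
  · simpa [Matrix.updateRow_ne hab] using hG.contDiffOn a b

theorem inv_mul {y : EuclideanSpace ℝ (Fin n)} (hy : y ∈ Ω) : (G y)⁻¹ * G y = 1 :=
  Matrix.nonsing_inv_mul _ (hG.det_ne hy).isUnit

theorem mul_inv {y : EuclideanSpace ℝ (Fin n)} (hy : y ∈ Ω) : G y * (G y)⁻¹ = 1 :=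
  Matrix.mul_nonsing_inv _ (hG.det_ne hy).isUnit

theorem contDiffOn_christoffel (k i j : Fin n) : ContDiffOn ℝ ∞ (christoffel G k i j) Ω := by
  have h (a b c : Fin n) := contDiffOn_partialDeriv hG.isOpen (hG.contDiffOn b c) a
  exact contDiffOn_const.mul (ContDiffOn.sum fun l _ ↦
    (hG.contDiffOn_inv k l).mul (((h i j l).add (h j i l)).sub (h l i j)))

theorem contDiffOn_ricci (i j : Fin n) : ContDiffOn ℝ ∞ (ricci G i j) Ω := by
  have h := hG.contDiffOn_christoffel
  have h' (a b c d : Fin n) := contDiffOn_partialDeriv hG.isOpen (h b c d) a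
  exact (ContDiffOn.sum fun k _ ↦ (h' k k i j).sub (h' j k i k)).add
    (ContDiffOn.sum fun k _ ↦ ContDiffOn.sum fun l _ ↦
      ((h k k l).mul (h l i j)).sub ((h k j l).mul (h l i k)))

theorem differentiableAt_of {f : EuclideanSpace ℝ (Fin n) → ℝ} (hf : ContDiffOn ℝ ∞ f Ω)
    {y : EuclideanSpace ℝ (Fin n)} (hy : y ∈ Ω) : DifferentiableAt ℝ f y :=
  (hf.contDiffAt (hG.isOpen.mem_nhds hy)).differentiableAt (by simp)

theorem partialDeriv_symm {y : EuclideanSpace ℝ (Fin n)} (hy : y ∈ Ω) (a i j : Fin n) :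
    partialDeriv a (fun z ↦ G z i j) y = partialDeriv a (fun z ↦ G z j i) y :=
  partialDeriv_congr (by
    filter_upwards [hG.isOpen.mem_nhds hy] with z hz using hG.symm hz i j) a

theorem christoffel_symm {y : EuclideanSpace ℝ (Fin n)} (hy : y ∈ Ω) (k i j : Fin n) :
    christoffel G k i j y = christoffel G k j i y := by
  simp only [christoffel]
  congr 1
  refine Finset.sum_congr rfl fun l _ ↦ ?_
  rw [hG.partialDeriv_symm hy l i j]
  ring

/-- Derivative of the inverse matrix. -/
theorem partialDeriv_inv {y : EuclideanSpace ℝ (Fin n)} (hy : y ∈ Ω) (a k l : Fin n) :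
    partialDeriv a (fun z ↦ (G z)⁻¹ k l) y =
      -∑ p, ∑ q, (G y)⁻¹ k p * partialDeriv a (fun z ↦ G z p q) y * (G y)⁻¹ q l := by
  set D : Matrix (Fin n) (Fin n) ℝ := Matrix.of fun i j ↦ partialDeriv a (fun z ↦ G z i j) y
    with hD
  set D' : Matrix (Fin n) (Fin n) ℝ := Matrix.of fun i j ↦ partialDeriv a (fun z ↦ (G z)⁻¹ i j) y
    with hD'
  have hdG (i j : Fin n) := hG.differentiableAt_of (hG.contDiffOn i j) hy
  have hdI (i j : Fin n) := hG.differentiableAt_of (hG.contDiffOn_inv i j) hy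
  -- Differentiate `G⁻¹ * G = 1`.
  have key : D' * G y + (G y)⁻¹ * D = 0 := by
    ext i j
    have h1 : partialDeriv a (fun z ↦ ∑ m, (G z)⁻¹ i m * G z m j) y = 0 := by
      rw [partialDeriv_congr (g := fun _ ↦ (1 : Matrix (Fin n) (Fin n) ℝ) i j),
        partialDeriv_const]
      filter_upwards [hG.isOpen.mem_nhds hy] with z hz
      rw [← Matrix.mul_apply, hG.inv_mul hz]
    rw [partialDeriv_sum _ fun m _ ↦ (hdI i m).fun_mul (hdG m j)] at h1
    simp only [partialDeriv_mul (hdI _ _) (hdG _ _), Finset.sum_add_distrib] at h1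
    simpa [Matrix.mul_apply, hD, hD'] using h1
  have h2 : D' = -((G y)⁻¹ * D * (G y)⁻¹) := by
    have h3 : D' * G y * (G y)⁻¹ = -((G y)⁻¹ * D) * (G y)⁻¹ := by
      rw [eq_neg_of_add_eq_zero_left key]
    rwa [Matrix.mul_assoc, hG.mul_inv hy, Matrix.mul_one, neg_mul] at h3
  have h4 := congrFun (congrFun h2 k) l
  rw [hD'] at h4
  simp only [Matrix.of_apply, Matrix.neg_apply, Matrix.mul_apply, Finset.sum_mul, hD] at h4
  rw [h4, Finset.sum_comm]

/-- The derivative of the Christoffel symbols, in terms of the 2-jet of the metric. -/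
theorem partialDeriv_christoffel {y : EuclideanSpace ℝ (Fin n)} (hy : y ∈ Ω) (a k i j : Fin n) :
    partialDeriv a (christoffel G k i j) y = 1 / 2 * ∑ l,
      ((-∑ p, ∑ q, (G y)⁻¹ k p * partialDeriv a (fun z ↦ G z p q) y * (G y)⁻¹ q l) *
        (partialDeriv i (fun z ↦ G z j l) y + partialDeriv j (fun z ↦ G z i l) y
          - partialDeriv l (fun z ↦ G z i j) y) +
      (G y)⁻¹ k l * (partialDeriv a (partialDeriv i fun z ↦ G z j l) y +
        partialDeriv a (partialDeriv j fun z ↦ G z i l) y -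
        partialDeriv a (partialDeriv l fun z ↦ G z i j) y)) := by
  have hdI (i j : Fin n) := hG.differentiableAt_of (hG.contDiffOn_inv i j) hy
  have hd (a b c : Fin n) :=
    hG.differentiableAt_of (contDiffOn_partialDeriv hG.isOpen (hG.contDiffOn b c) a) hy
  have hs (l : Fin n) := ((hd i j l).fun_add (hd j i l)).fun_sub (hd l i j)
  unfold christoffel
  rw [partialDeriv_const_mul _ (DifferentiableAt.fun_sum fun l _ ↦ (hdI k l).fun_mul (hs l)),
    partialDeriv_sum _ fun l _ ↦ (hdI k l).fun_mul (hs l)]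
  congr 1
  refine Finset.sum_congr rfl fun l _ ↦ ?_
  rw [partialDeriv_mul (hdI k l) (hs l), hG.partialDeriv_inv hy,
    partialDeriv_sub ((hd i j l).fun_add (hd j i l)) (hd l i j),
    partialDeriv_add (hd i j l) (hd j i l)]

end SmoothMetricOn

end Coordinates

/-! ### Conformal change of the connection and of the Ricci tensor on null vectors. -/

section ConformalChange

variable {n : ℕ}

theorem sum_comm_four (F : Fin n → Fin n → Fin n → Fin n → ℝ) :
    ∑ i, ∑ j, ∑ k, ∑ l, F i j k l = ∑ k, ∑ l, ∑ i, ∑ j, F i j k l := by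
  rw [Finset.sum_congr rfl fun i _ ↦ Finset.sum_comm, Finset.sum_comm]
  refine Finset.sum_congr rfl fun k _ ↦ ?_
  rw [Finset.sum_congr rfl fun i _ ↦ Finset.sum_comm, Finset.sum_comm]

/-- The contraction of the Ricci tensor with a vector, in terms of the contractions of the
Christoffel symbols and of their derivatives. -/
theorem ricci_contract (G : EuclideanSpace ℝ (Fin n) → Matrix (Fin n) (Fin n) ℝ)
    (y : EuclideanSpace ℝ (Fin n)) (v : Fin n → ℝ) :
    ∑ i, ∑ j, ricci G i j y * v i * v j =
      ∑ i, ∑ j, (∑ k, partialDeriv k (christoffel G k i j) y) * v i * v j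
      - ∑ i, ∑ j, (∑ k, partialDeriv j (christoffel G k i k) y) * v i * v j
      + ∑ l, (∑ k, christoffel G k k l y) * ∑ i, ∑ j, christoffel G l i j y * v i * v j
      - ∑ k, ∑ l, (∑ j, christoffel G k j l y * v j) * ∑ i, christoffel G l i k y * v i := by
  have h1 : ∑ l, (∑ k, christoffel G k k l y) * ∑ i, ∑ j, christoffel G l i j y * v i * v j =
      ∑ i, ∑ j, (∑ k, ∑ l, christoffel G k k l y * christoffel G l i j y) * v i * v j := by
    simp only [Finset.sum_mul]
    rw [sum_comm_four, Finset.sum_comm]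
    simp only [Finset.mul_sum, mul_assoc]
  have h2 : ∑ k, ∑ l, (∑ j, christoffel G k j l y * v j) * ∑ i, christoffel G l i k y * v i =
      ∑ i, ∑ j, (∑ k, ∑ l, christoffel G k j l y * christoffel G l i k y) * v i * v j := by
    simp only [Finset.sum_mul]
    rw [sum_comm_four]
    refine Finset.sum_congr rfl fun k _ ↦ Finset.sum_congr rfl fun l _ ↦ ?_
    rw [Finset.sum_comm]
    simp only [Finset.mul_sum]
    refine Finset.sum_congr rfl fun j _ ↦ Finset.sum_congr rfl fun i _ ↦ ?_
    ring
  rw [h1, h2]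
  simp only [← Finset.sum_add_distrib, ← Finset.sum_sub_distrib]
  refine Finset.sum_congr rfl fun i _ ↦ Finset.sum_congr rfl fun j _ ↦ ?_
  simp only [ricci, Finset.sum_sub_distrib]
  ring

variable {G G' : EuclideanSpace ℝ (Fin n) → Matrix (Fin n) (Fin n) ℝ}
  {Ω : Set (EuclideanSpace ℝ (Fin n))} {f : EuclideanSpace ℝ (Fin n) → ℝ}

/-- The gradient of `f` with respect to `G`, in coordinates. -/
def gradComp (G : EuclideanSpace ℝ (Fin n) → Matrix (Fin n) (Fin n) ℝ)
    (f : EuclideanSpace ℝ (Fin n) → ℝ) (k : Fin n) (y : EuclideanSpace ℝ (Fin n)) : ℝ :=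
  ∑ l, (G y)⁻¹ k l * partialDeriv l f y

/-- The difference of the Levi-Civita connections of `e ^ f • G` and `G`. -/
def conformalShift (G : EuclideanSpace ℝ (Fin n) → Matrix (Fin n) (Fin n) ℝ)
    (f : EuclideanSpace ℝ (Fin n) → ℝ) (k i j : Fin n) (y : EuclideanSpace ℝ (Fin n)) : ℝ :=
  1 / 2 * ((1 : Matrix (Fin n) (Fin n) ℝ) k i * partialDeriv j f y +
    (1 : Matrix (Fin n) (Fin n) ℝ) k j * partialDeriv i f y - G y i j * gradComp G f k y)

/-- Differentiating `e ^ f * G` adds `∂f * G` to each derivative of the metric, and the factor `e ^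
f` cancels the `e ^ (-f)` of the inverse matrix. -/
theorem christoffel_conformal (hG : SmoothMetricOn G Ω) (hf : ContDiffOn ℝ ∞ f Ω)
    (hG' : ∀ y ∈ Ω, ∀ i j, G' y i j = Real.exp (f y) * G y i j)
    {y : EuclideanSpace ℝ (Fin n)} (hy : y ∈ Ω) (k i j : Fin n) :
    christoffel G' k i j y = christoffel G k i j y + conformalShift G f k i j y := by
  have hdf := hG.differentiableAt_of hf hy
  have hdG (i j : Fin n) := hG.differentiableAt_of (hG.contDiffOn i j) hy
  have hd (a i j : Fin n) : partialDeriv a (fun z ↦ G' z i j) y =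
      Real.exp (f y) * (partialDeriv a (fun z ↦ G z i j) y + partialDeriv a f y * G y i j) := by
    rw [partialDeriv_congr (g := fun z ↦ Real.exp (f z) * G z i j),
      partialDeriv_mul hdf.exp (hdG i j), partialDeriv_exp hdf]
    · ring
    · filter_upwards [hG.isOpen.mem_nhds hy] with z hz using hG' z hz i j
  have hI : (G' y)⁻¹ = Real.exp (-f y) • (G y)⁻¹ := by
    have h1 : G' y = Real.exp (f y) • G y := by
      ext a b
      simp [hG' y hy a b]
    refine Matrix.inv_eq_left_inv ?_
    rw [h1, Matrix.smul_mul, Matrix.mul_smul, smul_smul, hG.inv_mul hy, ← Real.exp_add]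
    simp
  -- Expanding the Kronecker deltas as sums over `l` makes both sides a single sum, compared term by
  -- term.
  have hδ (k i : Fin n) : ∑ l, (G y)⁻¹ k l * G y i l = (1 : Matrix (Fin n) (Fin n) ℝ) k i := by
    rw [← hG.inv_mul hy, Matrix.mul_apply]
    exact Finset.sum_congr rfl fun l _ ↦ by rw [hG.symm hy i l]
  have he : Real.exp (-f y) * Real.exp (f y) = 1 := by rw [← Real.exp_add]; simp
  rw [conformalShift, ← hδ k i, ← hδ k j, gradComp]
  simp only [christoffel, hd, hI, Matrix.smul_apply, smul_eq_mul]
  rw [← mul_add, Finset.mul_sum (s := Finset.univ) (a := G y i j), Finset.sum_mul, Finset.sum_mul,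
    ← Finset.sum_add_distrib, ← Finset.sum_sub_distrib, ← Finset.sum_add_distrib]
  congr 1
  refine Finset.sum_congr rfl fun l _ ↦ ?_
  linear_combination ((G y)⁻¹ k l * (partialDeriv i (fun z ↦ G z j l) y +
    partialDeriv i f y * G y j l + (partialDeriv j (fun z ↦ G z i l) y +
    partialDeriv j f y * G y i l) - (partialDeriv l (fun z ↦ G z i j) y +
    partialDeriv l f y * G y i j))) * he

variable {y : EuclideanSpace ℝ (Fin n)} {v : Fin n → ℝ}

theorem sum_metric_mul_gradComp (hG : SmoothMetricOn G Ω) (hy : y ∈ Ω) (l : Fin n) :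
    ∑ k, G y l k * gradComp G f k y = partialDeriv l f y := by
  have h := congrArg (fun A ↦ Matrix.mulVec A (fun l ↦ partialDeriv l f y) l) (hG.mul_inv hy)
  simp only [Matrix.one_mulVec] at h
  rw [← Matrix.mulVec_mulVec] at h
  exact h

theorem conformalShift_trace (hG : SmoothMetricOn G Ω) (hy : y ∈ Ω) (l : Fin n) :
    ∑ k, conformalShift G f k k l y = n / 2 * partialDeriv l f y := by
  have h : ∑ k, G y k l * gradComp G f k y = partialDeriv l f y := by
    rw [← sum_metric_mul_gradComp (f := f) hG hy l]
    exact Finset.sum_congr rfl fun k _ ↦ by rw [hG.symm hy k l]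
  simp only [conformalShift, ← Finset.mul_sum, Finset.sum_sub_distrib, Finset.sum_add_distrib, h]
  simp [Matrix.one_apply]
  ring

theorem conformalShift_symm (hG : SmoothMetricOn G Ω) (hy : y ∈ Ω) (k i j : Fin n) :
    conformalShift G f k i j y = conformalShift G f k j i y := by
  rw [conformalShift, conformalShift, hG.symm hy i j]
  ring

/-- The gradient term carries the factor `G(v, v) = 0`. What is left is proportional to `v`, so a
conformal change only reparametrizes lightlike geodesics. -/
theorem conformalShift_null (hv : ∑ i, ∑ j, G y i j * v i * v j = 0) (l : Fin n) :
    ∑ i, ∑ j, conformalShift G f l i j y * v i * v j = (∑ i, partialDeriv i f y * v i) * v l := by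
  have h (i j : Fin n) : conformalShift G f l i j y * v i * v j =
      1 / 2 * ((1 : Matrix (Fin n) (Fin n) ℝ) l i * v i * (partialDeriv j f y * v j) +
        (1 : Matrix (Fin n) (Fin n) ℝ) l j * v j * (partialDeriv i f y * v i) -
        gradComp G f l y * (G y i j * v i * v j)) := by
    rw [conformalShift]
    ring
  simp only [h, ← Finset.mul_sum, Finset.sum_sub_distrib, Finset.sum_add_distrib, hv,
    ← Finset.sum_mul]
  simp [Matrix.one_apply]
  ring

/-- As an endomorphism this is `½ (v ⊗ df + df(v) · 1 - grad f ⊗ G(v, ·))`, the shape treated in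
`sum_rankTwo_sq`. -/
theorem conformalShift_contract (k l : Fin n) :
    ∑ j, conformalShift G f k j l y * v j =
      1 / 2 * (v k * partialDeriv l f y +
        (1 : Matrix (Fin n) (Fin n) ℝ) k l * (∑ i, partialDeriv i f y * v i) -
        gradComp G f k y * ∑ j, G y j l * v j) := by
  have h (j : Fin n) : conformalShift G f k j l y * v j =
      1 / 2 * ((1 : Matrix (Fin n) (Fin n) ℝ) k j * v j * partialDeriv l f y +
        (1 : Matrix (Fin n) (Fin n) ℝ) k l * (partialDeriv j f y * v j) -
        gradComp G f k y * (G y j l * v j)) := by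
    rw [conformalShift]
    ring
  simp only [h, ← Finset.mul_sum, Finset.sum_sub_distrib, Finset.sum_add_distrib, ← Finset.sum_mul]
  simp [Matrix.one_apply]

/-- Trace of the square of `½ (a ⊗ b + s · 1 - c ⊗ d)`. It is applied with `a = v`, `b = df`, `c =
grad f`, `d = G(v, ·)`; then `had` is the nullity of `v`, which removes the cross term. -/
theorem sum_rankTwo_sq {a b c d : Fin n → ℝ} {s : ℝ} (hab : ∑ i, b i * a i = s)
    (had : ∑ i, a i * d i = 0) (hcd : ∑ i, c i * d i = s) :
    ∑ k, ∑ l, 1 / 2 * (a k * b l + (1 : Matrix (Fin n) (Fin n) ℝ) k l * s - c k * d l) *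
      (1 / 2 * (a l * b k + (1 : Matrix (Fin n) (Fin n) ℝ) l k * s - c l * d k)) =
      (n + 2) / 4 * s ^ 2 := by
  have h (k l : Fin n) :
      1 / 2 * (a k * b l + (1 : Matrix (Fin n) (Fin n) ℝ) k l * s - c k * d l) *
      (1 / 2 * (a l * b k + (1 : Matrix (Fin n) (Fin n) ℝ) l k * s - c l * d k)) =
      1 / 4 * (b k * a k * (b l * a l) + c k * d k * (c l * d l)
        - a k * d k * (c l * b l) - c k * b k * (a l * d l)
        + (1 : Matrix (Fin n) (Fin n) ℝ) k l * (s * (b k * a l))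
        + (1 : Matrix (Fin n) (Fin n) ℝ) l k * (s * (a k * b l))
        - (1 : Matrix (Fin n) (Fin n) ℝ) k l * (s * (c l * d k))
        - (1 : Matrix (Fin n) (Fin n) ℝ) l k * (s * (c k * d l))
        + (1 : Matrix (Fin n) (Fin n) ℝ) k l * (1 : Matrix (Fin n) (Fin n) ℝ) l k * s ^ 2) := by
    ring
  have hba : ∑ i, a i * b i = s := by rw [← hab]; exact Finset.sum_congr rfl fun i _ ↦ mul_comm _ _
  simp only [h, ← Finset.mul_sum, Finset.sum_sub_distrib, Finset.sum_add_distrib, hab, had, hcd,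
    ← Finset.sum_mul]
  simp [Matrix.one_apply, ← Finset.mul_sum, hab, hcd, hba]
  ring

/-- Lowering the index of the Christoffel symbols. -/
theorem sum_metric_mul_christoffel (hG : SmoothMetricOn G Ω) (hy : y ∈ Ω) (m j l : Fin n) :
    ∑ k, G y m k * christoffel G k j l y = 1 / 2 * (partialDeriv j (fun z ↦ G z l m) y +
      partialDeriv l (fun z ↦ G z j m) y - partialDeriv m (fun z ↦ G z j l) y) := by
  have h := congrArg (fun A ↦ Matrix.mulVec A (fun m ↦ 1 / 2 * (partialDeriv j (fun z ↦ G z l m) y +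
      partialDeriv l (fun z ↦ G z j m) y - partialDeriv m (fun z ↦ G z j l) y)) m) (hG.mul_inv hy)
  simp only [Matrix.one_mulVec] at h
  rw [← Matrix.mulVec_mulVec] at h
  rw [← h]
  refine Finset.sum_congr rfl fun k _ ↦ ?_
  rw [christoffel, Matrix.mulVec, dotProduct, Finset.mul_sum]
  congr 1
  exact Finset.sum_congr rfl fun l _ ↦ by ring

/-- Among the three derivatives in the lowered Christoffel symbol, two are exchanged by swapping the
two copies of `v` and cancel. -/
theorem sum_christoffel_contract (hG : SmoothMetricOn G Ω) (hy : y ∈ Ω) (l : Fin n) :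
    ∑ k, (∑ j, christoffel G k j l y * v j) * ∑ m, G y m k * v m =
      1 / 2 * ∑ i, ∑ j, partialDeriv l (fun z ↦ G z i j) y * v i * v j := by
  have h1 : ∑ k, (∑ j, christoffel G k j l y * v j) * ∑ m, G y m k * v m =
      ∑ j, ∑ m, (∑ k, G y m k * christoffel G k j l y) * v j * v m := by
    simp only [Finset.sum_mul, Finset.mul_sum]
    rw [Finset.sum_congr rfl fun k _ ↦ Finset.sum_comm, Finset.sum_comm]
    rw [Finset.sum_congr rfl fun k _ ↦ Finset.sum_comm]
    refine Finset.sum_congr rfl fun j _ ↦ Finset.sum_congr rfl fun m _ ↦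
      Finset.sum_congr rfl fun k _ ↦ ?_
    ring
  have h2 : ∑ j, ∑ m, partialDeriv j (fun z ↦ G z l m) y * v j * v m =
      ∑ j, ∑ m, partialDeriv m (fun z ↦ G z j l) y * v j * v m := by
    rw [Finset.sum_comm]
    refine Finset.sum_congr rfl fun j _ ↦ Finset.sum_congr rfl fun m _ ↦ ?_
    rw [hG.partialDeriv_symm hy m l j]
    ring
  rw [h1]
  simp only [sum_metric_mul_christoffel hG hy]
  have h (j m : Fin n) : 1 / 2 * (partialDeriv j (fun z ↦ G z l m) y +
      partialDeriv l (fun z ↦ G z j m) y - partialDeriv m (fun z ↦ G z j l) y) * v j * v m =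
      1 / 2 * (partialDeriv j (fun z ↦ G z l m) y * v j * v m +
      partialDeriv l (fun z ↦ G z j m) y * v j * v m -
      partialDeriv m (fun z ↦ G z j l) y * v j * v m) := by ring
  simp only [h, ← Finset.mul_sum, Finset.sum_sub_distrib, Finset.sum_add_distrib]
  rw [h2]
  ring

/-- The mixed term in the quadratic part of the Ricci tensor of `e ^ f • G`. The last sum is not
tensorial; it cancels in `ricci_conformal`. -/
theorem sum_christoffel_mul_conformalShift (hG : SmoothMetricOn G Ω) (hy : y ∈ Ω) :
    ∑ k, ∑ l, (∑ j, christoffel G k j l y * v j) * ∑ i, conformalShift G f l i k y * v i =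
      1 / 2 * (∑ k, partialDeriv k f y * (∑ i, ∑ j, christoffel G k i j y * v i * v j) +
        (∑ i, partialDeriv i f y * v i) * (∑ l, (∑ k, christoffel G k k l y) * v l) -
        1 / 2 * ∑ l, gradComp G f l y *
          ∑ i, ∑ j, partialDeriv l (fun z ↦ G z i j) y * v i * v j) := by
  simp only [conformalShift_contract]
  have h (k l : Fin n) : (∑ j, christoffel G k j l y * v j) *
      (1 / 2 * (v l * partialDeriv k f y +
        (1 : Matrix (Fin n) (Fin n) ℝ) l k * (∑ i, partialDeriv i f y * v i) -
        gradComp G f l y * ∑ j, G y j k * v j)) =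
      1 / 2 * (partialDeriv k f y * ((∑ j, christoffel G k j l y * v j) * v l) +
        (∑ i, partialDeriv i f y * v i) *
          ((1 : Matrix (Fin n) (Fin n) ℝ) l k * (∑ j, christoffel G k j l y * v j)) -
        gradComp G f l y * ((∑ j, christoffel G k j l y * v j) * ∑ j, G y j k * v j)) := by
    ring
  simp only [h, ← Finset.mul_sum, Finset.sum_sub_distrib, Finset.sum_add_distrib]
  congr 1
  congr 1
  · congr 1
    · refine Finset.sum_congr rfl fun k _ ↦ ?_
      congr 1
      rw [Finset.sum_comm]
      simp only [Finset.sum_mul]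
    · congr 1
      simp only [Matrix.one_apply, ite_mul, one_mul, zero_mul, Finset.sum_ite_eq',
        Finset.mem_univ, if_true, Finset.sum_mul]
      rw [Finset.sum_comm]
      refine Finset.sum_congr rfl fun j _ ↦ Finset.sum_congr rfl fun k _ ↦ ?_
      rw [hG.christoffel_symm hy]
  · rw [Finset.sum_comm, Finset.mul_sum]
    refine Finset.sum_congr rfl fun l _ ↦ ?_
    rw [← Finset.mul_sum, sum_christoffel_contract hG hy]
    ring

theorem contDiffOn_gradComp (hG : SmoothMetricOn G Ω) (hf : ContDiffOn ℝ ∞ f Ω) (k : Fin n) :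
    ContDiffOn ℝ ∞ (gradComp G f k) Ω :=
  ContDiffOn.sum fun l _ ↦ (hG.contDiffOn_inv k l).mul (contDiffOn_partialDeriv hG.isOpen hf l)

theorem contDiffOn_conformalShift (hG : SmoothMetricOn G Ω) (hf : ContDiffOn ℝ ∞ f Ω)
    (k i j : Fin n) : ContDiffOn ℝ ∞ (conformalShift G f k i j) Ω := by
  have h (i : Fin n) := contDiffOn_partialDeriv hG.isOpen hf i
  exact contDiffOn_const.mul (((contDiffOn_const.mul (h j)).add (contDiffOn_const.mul (h i))).sub
    ((hG.contDiffOn i j).mul (contDiffOn_gradComp hG hf k)))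

theorem partialDeriv_conformalShift (hG : SmoothMetricOn G Ω) (hf : ContDiffOn ℝ ∞ f Ω)
    (hy : y ∈ Ω) (a k i j : Fin n) :
    partialDeriv a (conformalShift G f k i j) y =
      1 / 2 * ((1 : Matrix (Fin n) (Fin n) ℝ) k i * partialDeriv a (partialDeriv j f) y +
        (1 : Matrix (Fin n) (Fin n) ℝ) k j * partialDeriv a (partialDeriv i f) y -
        (partialDeriv a (fun z ↦ G z i j) y * gradComp G f k y +
          G y i j * partialDeriv a (gradComp G f k) y)) := by
  have h (i : Fin n) := hG.differentiableAt_of (contDiffOn_partialDeriv hG.isOpen hf i) hy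
  have hg := hG.differentiableAt_of (contDiffOn_gradComp hG hf k) hy
  have h' := hG.differentiableAt_of (hG.contDiffOn i j) hy
  have h1 (k i j : Fin n) := (h j).const_mul ((1 : Matrix (Fin n) (Fin n) ℝ) k i)
  unfold conformalShift
  rw [partialDeriv_const_mul _ (((h1 k i j).fun_add (h1 k j i)).fun_sub (h'.fun_mul hg)),
    partialDeriv_sub ((h1 k i j).fun_add (h1 k j i)) (h'.fun_mul hg),
    partialDeriv_add (h1 k i j) (h1 k j i), partialDeriv_const_mul _ (h j),
    partialDeriv_const_mul _ (h i), partialDeriv_mul h' hg]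

/-- Behaviour of the Ricci tensor on null vectors under a conformal change. -/
theorem ricci_conformal (hG : SmoothMetricOn G Ω) (hf : ContDiffOn ℝ ∞ f Ω)
    (hG' : ∀ y ∈ Ω, ∀ i j, G' y i j = Real.exp (f y) * G y i j) (hy : y ∈ Ω)
    (hv : ∑ i, ∑ j, G y i j * v i * v j = 0) :
    ∑ i, ∑ j, ricci G' i j y * v i * v j = ∑ i, ∑ j, ricci G i j y * v i * v j -
      (n - 2) / 2 * (∑ i, ∑ j, partialDeriv i (partialDeriv j f) y * v i * v j -
        ∑ k, partialDeriv k f y * (∑ i, ∑ j, christoffel G k i j y * v i * v j) -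
        1 / 2 * (∑ i, partialDeriv i f y * v i) ^ 2) := by
  have hΓ (k i j : Fin n) := christoffel_conformal hG hf hG' hy k i j
  have hdΓ (a k i j : Fin n) : partialDeriv a (christoffel G' k i j) y =
      partialDeriv a (christoffel G k i j) y + partialDeriv a (conformalShift G f k i j) y := by
    rw [partialDeriv_congr (g := fun z ↦ christoffel G k i j z + conformalShift G f k i j z),
      partialDeriv_add (hG.differentiableAt_of (hG.contDiffOn_christoffel k i j) hy)
        (hG.differentiableAt_of (contDiffOn_conformalShift hG hf k i j) hy)]
    filter_upwards [hG.isOpen.mem_nhds hy] with z hz using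
      christoffel_conformal hG hf hG' hz k i j
  -- The divergence of `grad f` disappears because `v` is null.
  have hP : ∑ i, ∑ j, (∑ k, partialDeriv k (conformalShift G f k i j) y) * v i * v j =
      ∑ i, ∑ j, partialDeriv i (partialDeriv j f) y * v i * v j - 1 / 2 * ∑ l, gradComp G f l y *
          ∑ i, ∑ j, partialDeriv l (fun z ↦ G z i j) y * v i * v j := by
    have h (i j : Fin n) : (∑ k, partialDeriv k (conformalShift G f k i j) y) * v i * v j =
        1 / 2 * (partialDeriv i (partialDeriv j f) y * v i * v j +
          partialDeriv j (partialDeriv i f) y * v j * v i -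
          ∑ l, gradComp G f l y * (partialDeriv l (fun z ↦ G z i j) y * v i * v j) -
          (∑ l, partialDeriv l (gradComp G f l) y) * (G y i j * v i * v j)) := by
      simp only [partialDeriv_conformalShift hG hf hy, ← Finset.mul_sum, Finset.sum_sub_distrib,
        Finset.sum_add_distrib]
      simp only [Matrix.one_apply, ite_mul, one_mul, zero_mul, Finset.sum_ite_eq',
        Finset.mem_univ, if_true]
      have h1 : ∑ l, gradComp G f l y * (partialDeriv l (fun z ↦ G z i j) y * v i * v j) =
          (∑ l, partialDeriv l (fun z ↦ G z i j) y * gradComp G f l y) * v i * v j := by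
        rw [Finset.sum_mul, Finset.sum_mul]
        exact Finset.sum_congr rfl fun l _ ↦ by ring
      rw [h1]
      ring
    have h2 : ∑ i, ∑ j, partialDeriv j (partialDeriv i f) y * v j * v i =
        ∑ i, ∑ j, partialDeriv i (partialDeriv j f) y * v i * v j := Finset.sum_comm
    have h3 : ∑ i, ∑ j, ∑ l, gradComp G f l y * (partialDeriv l (fun z ↦ G z i j) y * v i * v j) =
        ∑ l, gradComp G f l y * ∑ i, ∑ j, partialDeriv l (fun z ↦ G z i j) y * v i * v j := by
      simp only [Finset.mul_sum]
      rw [Finset.sum_congr rfl fun i _ ↦ Finset.sum_comm, Finset.sum_comm]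
    simp only [h, ← Finset.mul_sum, Finset.sum_sub_distrib, Finset.sum_add_distrib, hv, h2, h3]
    ring
  have hQ : ∑ i, ∑ j, (∑ k, partialDeriv j (conformalShift G f k i k) y) * v i * v j =
      n / 2 * ∑ i, ∑ j, partialDeriv i (partialDeriv j f) y * v i * v j := by
    have h (i j : Fin n) : ∑ k, partialDeriv j (conformalShift G f k i k) y =
        n / 2 * partialDeriv j (partialDeriv i f) y := by
      rw [← partialDeriv_sum _ fun k _ ↦
        hG.differentiableAt_of (contDiffOn_conformalShift hG hf k i k) hy,
        ← partialDeriv_const_mul _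
          (hG.differentiableAt_of (contDiffOn_partialDeriv hG.isOpen hf i) hy)]
      refine partialDeriv_congr ?_ j
      filter_upwards [hG.isOpen.mem_nhds hy] with z hz
      rw [← conformalShift_trace hG hz]
      exact Finset.sum_congr rfl fun k _ ↦ conformalShift_symm hG hz k i k
    simp only [h, mul_assoc, ← Finset.mul_sum]
    rw [Finset.sum_comm]
    congr 1
    exact Finset.sum_congr rfl fun i _ ↦ Finset.sum_congr rfl fun j _ ↦ by ring
  have hF : ∑ l, gradComp G f l y * ∑ j, G y j l * v j = ∑ i, partialDeriv i f y * v i := by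
    simp only [← sum_metric_mul_gradComp (f := f) hG hy, Finset.mul_sum, Finset.sum_mul]
    rw [Finset.sum_comm]
    exact Finset.sum_congr rfl fun i _ ↦ Finset.sum_congr rfl fun j _ ↦ by ring
  have hvb : ∑ l, v l * ∑ j, G y j l * v j = 0 := by
    rw [← hv, Finset.sum_comm]
    simp only [Finset.mul_sum]
    exact Finset.sum_congr rfl fun i _ ↦ Finset.sum_congr rfl fun j _ ↦ by ring
  have hS : ∑ k, ∑ l, (∑ j, conformalShift G f k j l y * v j) *
      ∑ i, conformalShift G f l i k y * v i =
      (n + 2) / 4 * (∑ i, partialDeriv i f y * v i) ^ 2 := by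
    simp only [conformalShift_contract]
    exact sum_rankTwo_sq rfl hvb hF
  have hM := sum_christoffel_mul_conformalShift (f := f) (v := v) hG hy
  have hM' : ∑ k, ∑ l, (∑ j, conformalShift G f k j l y * v j) *
      (∑ i, christoffel G l i k y * v i) =
      ∑ k, ∑ l, (∑ j, christoffel G k j l y * v j) * ∑ i, conformalShift G f l i k y * v i := by
    rw [Finset.sum_comm]
    exact Finset.sum_congr rfl fun i _ ↦ Finset.sum_congr rfl fun j _ ↦ mul_comm _ _
  -- Bookkeeping: the non-tensorial sum of `hP` cancels against the two equal mixed products. The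
  -- second derivatives of `f` get the coefficient `1 - n / 2`, the terms `∂f * Γ(v, v)` get `n / 2
  -- - 1`, and `df(v)²` gets `n / 2 - (n + 2) / 4 = (n - 2) / 4`.
  rw [ricci_contract, ricci_contract]
  simp only [hΓ, hdΓ, Finset.sum_add_distrib, add_mul, mul_add, hP, hQ, hS, hM', hM,
    conformalShift_trace hG hy, conformalShift_null hv]
  have e1 : ∑ l, (∑ k, christoffel G k k l y) * ((∑ i, partialDeriv i f y * v i) * v l) =
      (∑ i, partialDeriv i f y * v i) * ∑ l, (∑ k, christoffel G k k l y) * v l := by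
    rw [Finset.mul_sum]
    exact Finset.sum_congr rfl fun i _ ↦ by ring
  have e2 : ∑ l, (n / 2 * partialDeriv l f y) * ((∑ i, partialDeriv i f y * v i) * v l) =
      n / 2 * (∑ i, partialDeriv i f y * v i) ^ 2 := by
    rw [sq, ← mul_assoc, Finset.mul_sum]
    exact Finset.sum_congr rfl fun i _ ↦ by ring
  have e3 : ∑ l, (n / 2 * partialDeriv l f y) * (∑ i, ∑ j, christoffel G l i j y * v i * v j) =
      n / 2 * ∑ l, partialDeriv l f y * ∑ i, ∑ j, christoffel G l i j y * v i * v j := by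
    rw [Finset.mul_sum]
    exact Finset.sum_congr rfl fun i _ ↦ by ring
  rw [e1, e2, e3]
  ring

end ConformalChange

/-! ### Convergence of Christoffel symbols and Ricci tensors. -/

section Convergence

variable {n : ℕ} {ι : Type*}

/-- Continuous convergence of the 2-jets at `y` of a family of fields of matrices. -/
structure TendstoC2At (Gk : ι → EuclideanSpace ℝ (Fin n) → Matrix (Fin n) (Fin n) ℝ) (l : Filter ι)
    (G : EuclideanSpace ℝ (Fin n) → Matrix (Fin n) (Fin n) ℝ)
    (y : EuclideanSpace ℝ (Fin n)) : Prop where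
  zero (i j : Fin n) : Tendsto (fun p : ι × EuclideanSpace ℝ (Fin n) ↦ Gk p.1 p.2 i j)
    (l ×ˢ 𝓝 y) (𝓝 (G y i j))
  one (a i j : Fin n) : Tendsto (fun p : ι × EuclideanSpace ℝ (Fin n) ↦
    partialDeriv a (fun z ↦ Gk p.1 z i j) p.2) (l ×ˢ 𝓝 y) (𝓝 (partialDeriv a (fun z ↦ G z i j) y))
  two (a b i j : Fin n) : Tendsto (fun p : ι × EuclideanSpace ℝ (Fin n) ↦
    partialDeriv a (partialDeriv b fun z ↦ Gk p.1 z i j) p.2) (l ×ˢ 𝓝 y)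
    (𝓝 (partialDeriv a (partialDeriv b fun z ↦ G z i j) y))

namespace TendstoC2At

variable {Gk : ι → EuclideanSpace ℝ (Fin n) → Matrix (Fin n) (Fin n) ℝ} {l : Filter ι}
  {G : EuclideanSpace ℝ (Fin n) → Matrix (Fin n) (Fin n) ℝ} {Ω : Set (EuclideanSpace ℝ (Fin n))}
  {y : EuclideanSpace ℝ (Fin n)} (h : TendstoC2At Gk l G y) (hGk : ∀ k, SmoothMetricOn (Gk k) Ω)
  (hG : SmoothMetricOn G Ω) (hy : y ∈ Ω)

include h hG hy

theorem inv (i j : Fin n) : Tendsto (fun p : ι × EuclideanSpace ℝ (Fin n) ↦ (Gk p.1 p.2)⁻¹ i j)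
    (l ×ˢ 𝓝 y) (𝓝 ((G y)⁻¹ i j)) := by
  have hM : Tendsto (fun p : ι × EuclideanSpace ℝ (Fin n) ↦ Gk p.1 p.2) (l ×ˢ 𝓝 y) (𝓝 (G y)) :=
    tendsto_pi_nhds.2 fun i ↦ tendsto_pi_nhds.2 fun j ↦ h.zero i j
  have hdet := ((continuous_id.matrix_det).tendsto (G y)).comp hM
  have hadj := ((continuous_id.matrix_adjugate).tendsto (G y)).comp hM
  simp only [Matrix.inv_def, Matrix.smul_apply, Ring.inverse_eq_inv', smul_eq_mul]
  exact (hdet.inv₀ (hG.det_ne hy)).mul (((continuous_apply_apply i j).tendsto _).comp hadj)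

theorem christoffel (k i j : Fin n) : Tendsto (fun p : ι × EuclideanSpace ℝ (Fin n) ↦
    christoffel (Gk p.1) k i j p.2) (l ×ˢ 𝓝 y) (𝓝 (christoffel G k i j y)) :=
  tendsto_const_nhds.mul (tendsto_finsetSum _ fun m _ ↦
    (h.inv hG hy k m).mul (((h.one i j m).add (h.one j i m)).sub (h.one m i j)))

include hGk

/-- The explicit formula in terms of the 2-jet shows continuity for `C²` convergence. It holds only
on `Ω`, hence the restriction to points close to `y`. -/
theorem partialDeriv_christoffel (a k i j : Fin n) :
    Tendsto (fun p : ι × EuclideanSpace ℝ (Fin n) ↦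
      partialDeriv a (ConformalGeometry.christoffel (Gk p.1) k i j) p.2) (l ×ˢ 𝓝 y)
      (𝓝 (partialDeriv a (ConformalGeometry.christoffel G k i j) y)) := by
  rw [hG.partialDeriv_christoffel hy]
  have hI := h.inv hG hy
  have := tendsto_const_nhds (x := (1 / 2 : ℝ)) |>.mul (tendsto_finsetSum Finset.univ fun m _ ↦
    ((tendsto_finsetSum Finset.univ fun p _ ↦ tendsto_finsetSum Finset.univ fun q _ ↦
      ((hI k p).mul (h.one a p q)).mul (hI q m)).neg.mul
        (((h.one i j m).add (h.one j i m)).sub (h.one m i j))).add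
    ((hI k m).mul (((h.two a i j m).add (h.two a j i m)).sub (h.two a m i j))))
  refine this.congr' ?_
  filter_upwards [tendsto_snd.eventually (hG.isOpen.mem_nhds hy)] with p hp
  rw [(hGk p.1).partialDeriv_christoffel hp]

theorem ricci (i j : Fin n) : Tendsto (fun p : ι × EuclideanSpace ℝ (Fin n) ↦
    ricci (Gk p.1) i j p.2) (l ×ˢ 𝓝 y) (𝓝 (ricci G i j y)) := by
  have hΓ := h.christoffel hG hy
  have hd := h.partialDeriv_christoffel hGk hG hy
  exact (tendsto_finsetSum _ fun k _ ↦ (hd k k i j).sub (hd j k i k)).add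
    (tendsto_finsetSum _ fun k _ ↦ tendsto_finsetSum _ fun m _ ↦
      ((hΓ k k m).mul (hΓ m i j)).sub ((hΓ k j m).mul (hΓ m i k)))

end TendstoC2At

theorem iteratedFDeriv_one_eq_partialDeriv (f : EuclideanSpace ℝ (Fin n) → ℝ) (a : Fin n)
    (y : EuclideanSpace ℝ (Fin n)) :
    iteratedFDeriv ℝ 1 f y ![basisVec a] = partialDeriv a f y := by
  rw [iteratedFDeriv_one_apply]
  rfl

theorem iteratedFDeriv_two_eq_partialDeriv {f : EuclideanSpace ℝ (Fin n) → ℝ} (a b : Fin n)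
    {y : EuclideanSpace ℝ (Fin n)} (hf : DifferentiableAt ℝ (fderiv ℝ f) y) :
    iteratedFDeriv ℝ 2 f y ![basisVec a, basisVec b] = partialDeriv a (partialDeriv b f) y := by
  rw [iteratedFDeriv_two_apply]
  unfold partialDeriv
  rw [fderiv_clm_apply hf (differentiableAt_const _)]
  simp

end Convergence

/-! ### From metrics on the manifold to matrices in charts. -/

section Charts

variable {n : ℕ} {M : Type*} [TopologicalSpace M]
  [ChartedSpace (EuclideanSpace ℝ (Fin n)) M] [IsManifold (𝓡 n) ∞ M]

theorem contMDiffOn_chartVector (x₀ : M) (v : EuclideanSpace ℝ (Fin n)) :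
    ContMDiffOn 𝓘(ℝ, EuclideanSpace ℝ (Fin n)) ((𝓡 n).prod 𝓘(ℝ, EuclideanSpace ℝ (Fin n))) ∞
      (fun y ↦ (Bundle.TotalSpace.mk' (EuclideanSpace ℝ (Fin n))
        (E := fun x : M ↦ TangentSpace (𝓡 n) x) ((extChartAt (𝓡 n) x₀).symm y)
        (chartVector x₀ y v))) (extChartAt (𝓡 n) x₀).target := by
  have hopen : IsOpen (extChartAt (𝓡 n) x₀).target := isOpen_extChartAt_target x₀
  have h1 := (contMDiffOn_extChartAt_symm (I := 𝓡 n) (n := ∞) x₀).contMDiffOn_tangentMapWithin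
    (m := ∞) (by simp) hopen.uniqueMDiffOn
  have h2 : ContMDiff 𝓘(ℝ, EuclideanSpace ℝ (Fin n))
      (𝓘(ℝ, EuclideanSpace ℝ (Fin n)).prod 𝓘(ℝ, EuclideanSpace ℝ (Fin n))) ∞
      (fun y : EuclideanSpace ℝ (Fin n) ↦
        (Bundle.TotalSpace.mk' (EuclideanSpace ℝ (Fin n))
        (E := fun y : EuclideanSpace ℝ (Fin n) ↦
          TangentSpace 𝓘(ℝ, EuclideanSpace ℝ (Fin n)) y) y v)) :=
    contMDiff_vectorSpace_iff_contDiff.2 contDiff_const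
  refine (h1.comp h2.contMDiffOn fun y hy ↦ hy).congr fun y hy ↦ ?_
  simp only [Function.comp_apply, tangentMapWithin, chartVector]
  rw [mfderivWithin_of_isOpen hopen hy]

theorem PseudoMetric.contDiffOn_coord (g : PseudoMetric n M) (x₀ : M) (i j : Fin n) :
    ContDiffOn ℝ ∞ (fun y ↦ g.coord x₀ y i j) (extChartAt (𝓡 n) x₀).target := by
  have h1 := contMDiffOn_extChartAt_symm (I := 𝓡 n) (n := ∞) x₀
  have h2 := g.contMDiff.contMDiffOn (s := univ) |>.comp h1 fun _ _ ↦ mem_univ _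
  have h3 := ContMDiffOn.clm_bundle_apply₂ (F₁ := EuclideanSpace ℝ (Fin n))
    (F₂ := EuclideanSpace ℝ (Fin n)) (F₃ := ℝ)
    (E₁ := fun x : M ↦ TangentSpace (𝓡 n) x) (E₂ := fun x : M ↦ TangentSpace (𝓡 n) x)
    (E₃ := Bundle.Trivial M ℝ) (b := fun y ↦ (extChartAt (𝓡 n) x₀).symm y)
    (ψ := fun y ↦ g.form ((extChartAt (𝓡 n) x₀).symm y)) h2
    (contMDiffOn_chartVector x₀ (basisVec i)) (contMDiffOn_chartVector x₀ (basisVec j))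
  intro y hy
  have h4 := h3 y hy
  rw [Bundle.contMDiffWithinAt_totalSpace] at h4
  exact contMDiffWithinAt_iff_contDiffWithinAt.1 h4.2

/-- A kernel vector of the matrix is orthogonal to all coordinate fields; these span, since the
differential of the inverse chart is invertible, so the vector lies in the radical of `g`. -/
theorem PseudoMetric.coord_det_ne (g : PseudoMetric n M) (x₀ : M) {y : EuclideanSpace ℝ (Fin n)}
    (hy : y ∈ (extChartAt (𝓡 n) x₀).target) : (g.coord x₀ y).det ≠ 0 := by
  rw [Ne, ← Matrix.exists_mulVec_eq_zero_iff]
  rintro ⟨v, hv0, hv⟩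
  set T : EuclideanSpace ℝ (Fin n) →L[ℝ]
    TangentSpace (𝓡 n) ((extChartAt (𝓡 n) x₀).symm y) :=
    mfderiv (𝓡 n) (𝓡 n) (extChartAt (𝓡 n) x₀).symm y with hT
  have hinv : T.IsInvertible := by
    have := isInvertible_mfderivWithin_extChartAt_symm (I := 𝓡 n) hy
    rwa [modelWithCornersSelf_coe, range_id, mfderivWithin_univ] at this
  have key (i : Fin n) :
      g.form _ (T (∑ j, v j • basisVec j)) (T (basisVec i)) = 0 := by
    have hvi : ∑ j, g.coord x₀ y i j * v j = 0 := congrFun hv i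
    rw [g.symm, map_sum, map_sum, ← hvi]
    refine Finset.sum_congr rfl fun j _ ↦ ?_
    rw [map_smul, map_smul, smul_eq_mul, mul_comm]
    rfl
  have h0 : T (∑ j, v j • basisVec j) = 0 := by
    refine g.nondegenerate _ _ fun w ↦ ?_
    obtain ⟨z, rfl⟩ := hinv.bijective.2 w
    rw [← sum_smul_basisVec z, map_sum T fun i ↦ z i • basisVec i, map_sum]
    refine Finset.sum_eq_zero fun i _ ↦ ?_
    rw [map_smul, map_smul, key, smul_zero]
  have h1 : ∑ j, v j • basisVec j = (0 : EuclideanSpace ℝ (Fin n)) :=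
    hinv.bijective.1 (h0.trans (map_zero T).symm)
  refine hv0 (funext fun i ↦ ?_)
  have h2 := congrArg (fun w : EuclideanSpace ℝ (Fin n) ↦ w i) h1
  simpa [basisVec, Finset.sum_apply, Pi.single_apply] using h2

theorem PseudoMetric.smoothMetricOn_coord (g : PseudoMetric n M) (x₀ : M) :
    SmoothMetricOn (g.coord x₀) (extChartAt (𝓡 n) x₀).target where
  isOpen := isOpen_extChartAt_target x₀
  contDiffOn := g.contDiffOn_coord x₀
  det_ne := g.coord_det_ne x₀
  symm _ _ _ := g.symm _ _ _


/-- Uniform convergence on a compact neighbourhood of `y`, with a continuous limit, gives joint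
convergence along `l ×ˢ 𝓝 y`. This joint form can be composed with moving base points. -/
theorem PseudoMetric.tendstoC2At {ι : Type*} {l : Filter ι} {gk : ι → PseudoMetric n M}
    {g : PseudoMetric n M} (h : Tendsto gk l (𝓝 g)) (x₀ : M) {y : EuclideanSpace ℝ (Fin n)}
    (hy : y ∈ (extChartAt (𝓡 n) x₀).target) :
    TendstoC2At (fun k ↦ (gk k).coord x₀) l (g.coord x₀) y := by
  have hopen : IsOpen (extChartAt (𝓡 n) x₀).target := isOpen_extChartAt_target x₀
  obtain ⟨K, hKy, hKt, hK⟩ := local_compact_nhds (hopen.mem_nhds hy)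
  have key (m : Fin 3) (i j : Fin n) : Tendsto (fun p : ι × EuclideanSpace ℝ (Fin n) ↦
      iteratedFDeriv ℝ (m : ℕ) (fun z ↦ (gk p.1).coord x₀ z i j) p.2) (l ×ˢ 𝓝 y)
      (𝓝 (iteratedFDeriv ℝ (m : ℕ) (fun z ↦ g.coord x₀ z i j) y)) := by
    have hc : Continuous fun g : PseudoMetric n M ↦
        UniformOnFun.ofFun {K | IsCompact K ∧ K ⊆ (extChartAt (𝓡 n) x₀).target}
          (iteratedFDeriv ℝ (m : ℕ) fun z ↦ g.coord x₀ z i j) :=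
      continuous_iInf_dom (i := x₀) (continuous_iInf_dom (i := i) (continuous_iInf_dom (i := j)
        (continuous_iInf_dom (i := m) continuous_induced_dom)))
    have h1 := UniformOnFun.tendsto_iff_tendstoUniformlyOn.1 ((hc.tendsto g).comp h) K ⟨hK, hKt⟩
    have h2 : ContinuousAt (iteratedFDeriv ℝ (m : ℕ) fun z ↦ g.coord x₀ z i j) y :=
      (((g.contDiffOn_coord x₀ i j).contDiffAt (hopen.mem_nhds hy)).iteratedFDeriv_right
        (m := 0) (by simpa using mod_cast le_top)).continuousAt
    refine tendsto_comp_of_locally_uniform_limit h2 tendsto_snd fun u hu ↦ ⟨K, hKy, ?_⟩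
    exact tendsto_fst.eventually (h1 u hu)
  have smooth (g : PseudoMetric n M) (i j : Fin n) {z : EuclideanSpace ℝ (Fin n)}
      (hz : z ∈ (extChartAt (𝓡 n) x₀).target) :
      DifferentiableAt ℝ (fderiv ℝ fun z ↦ g.coord x₀ z i j) z :=
    (((g.contDiffOn_coord x₀ i j).fderiv_of_isOpen (m := ∞) hopen (by simp)).contDiffAt
      (hopen.mem_nhds hz)).differentiableAt (by simp)
  have happ {m : ℕ} (v : Fin m → EuclideanSpace ℝ (Fin n)) :
      Continuous fun A : EuclideanSpace ℝ (Fin n) [×m]→L[ℝ] ℝ ↦ A v := by fun_prop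
  refine ⟨fun i j ↦ ?_, fun a i j ↦ ?_, fun a b i j ↦ ?_⟩
  · simpa [Function.comp_def] using ((happ ![]).tendsto _).comp (key 0 i j)
  · have := ((happ ![basisVec a]).tendsto _).comp (key 1 i j)
    simpa only [Function.comp_def, Fin.val_one, iteratedFDeriv_one_eq_partialDeriv] using this
  · have := ((happ ![basisVec a, basisVec b]).tendsto _).comp (key 2 i j)
    simp only [Function.comp_def, Fin.val_two] at this
    rw [iteratedFDeriv_two_eq_partialDeriv a b (smooth g i j hy)] at this
    refine this.congr' ?_
    filter_upwards [tendsto_snd.eventually (hopen.mem_nhds hy)] with p hp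
    exact iteratedFDeriv_two_eq_partialDeriv a b (smooth (gk p.1) i j hp)

end Charts

section

/-! ### Projectively parametrized geodesics as solutions of a differential equation -/

section Reparametrization

variable {F : Type*} [NormedAddCommGroup F] [NormedSpace ℝ F]

theorem contDiffAt_deriv {y : ℝ → F} {t : ℝ} (hy : ContDiffAt ℝ ∞ y t) :
    ContDiffAt ℝ ∞ (deriv y) t :=
  (hy.fderiv_right (m := ∞) (by simp)).clm_apply contDiffAt_const

/-- Here `p` is the derivative of the inverse of `τ`. The same form serves for `τ = u⁻¹`, for the
inverse passage, and for affine maps, where `p` is constant. -/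
theorem deriv_comp_eq {y z : ℝ → F} {τ p : ℝ → ℝ} {s : ℝ} (hy : DifferentiableAt ℝ y (τ s))
    (hτ : HasDerivAt τ (p (τ s))⁻¹ s) (hz : z =ᶠ[𝓝 s] fun s ↦ y (τ s)) :
    deriv z s = (p (τ s))⁻¹ • deriv y (τ s) := by
  rw [hz.deriv_eq]
  exact (hy.hasDerivAt.scomp s hτ).deriv

theorem deriv_deriv_comp_eq {y z : ℝ → F} {τ p : ℝ → ℝ} {s p' : ℝ} (hy : ContDiffAt ℝ ∞ y (τ s))
    (hτ : ∀ᶠ r in 𝓝 s, HasDerivAt τ (p (τ r))⁻¹ r) (hp : HasDerivAt p p' (τ s)) (hp0 : p (τ s) ≠ 0)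
    (hz : z =ᶠ[𝓝 s] fun s ↦ y (τ s)) :
    deriv (deriv z) s = ((p (τ s))⁻¹ ^ 2) • deriv (deriv y) (τ s) -
      (p' * (p (τ s))⁻¹ ^ 3) • deriv y (τ s) := by
  have hτs := hτ.self_of_nhds
  have hy2 : ∀ᶠ t in 𝓝 (τ s), DifferentiableAt ℝ y t := by
    filter_upwards [(hy.of_le (m := 1) (by exact_mod_cast le_top)).eventually (by simp)] with t ht
    exact ht.differentiableAt (by simp)
  have h1 : deriv z =ᶠ[𝓝 s] fun r ↦ (p (τ r))⁻¹ • deriv y (τ r) := by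
    filter_upwards [hτ, hz.eventually_nhds, hτs.continuousAt.eventually hy2] with r h1 h2 h3
    exact deriv_comp_eq h3 h1 h2
  have hy' : DifferentiableAt ℝ (deriv y) (τ s) :=
    (contDiffAt_deriv hy).differentiableAt (by simp)
  have h2 := (hp.comp s hτs).fun_inv hp0
  have h3 := h2.fun_smul (hy'.hasDerivAt.scomp s hτs)
  rw [h1.deriv_eq]
  refine h3.deriv.trans ?_
  simp only [Function.comp_apply, smul_smul]
  rw [sub_eq_add_neg, ← neg_smul]
  congr 2
  · ring
  · field_simp

end Reparametrization

variable {n : ℕ} {M : Type*} [TopologicalSpace M]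
  [ChartedSpace (EuclideanSpace ℝ (Fin n)) M] [IsManifold (𝓡 n) ∞ M]

/-- The curve `γ` on the open set `I` is a lightlike geodesic with projective parametrization; the
function `φ` measures the failure of the parametrization to be affine. -/
structure ProjGeodesicOn (g : PseudoMetric n M) (γ : ℝ → M) (φ : ℝ → ℝ) (I : Set ℝ) : Prop where
  contMDiffOn : ContMDiffOn 𝓘(ℝ, ℝ) (𝓡 n) ∞ γ I
  null (x₀ : M) {t : ℝ} (ht : t ∈ I) (hs : γ t ∈ (extChartAt (𝓡 n) x₀).source) :
    ∑ i, ∑ j, g.coord x₀ (coordCurve n x₀ γ t) i j *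
      deriv (coordCurve n x₀ γ) t i * deriv (coordCurve n x₀ γ) t j = 0
  accel (x₀ : M) {t : ℝ} (ht : t ∈ I) (hs : γ t ∈ (extChartAt (𝓡 n) x₀).source) (k : Fin n) :
    deriv (deriv (coordCurve n x₀ γ)) t k +
      ∑ i, ∑ j, christoffel (g.coord x₀) k i j (coordCurve n x₀ γ t) *
        deriv (coordCurve n x₀ γ) t i * deriv (coordCurve n x₀ γ) t j =
      φ t * deriv (coordCurve n x₀ γ) t k
  riccati (x₀ : M) {t : ℝ} (ht : t ∈ I) (hs : γ t ∈ (extChartAt (𝓡 n) x₀).source) :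
    HasDerivAt φ (φ t ^ 2 / 2 - 2 / ((n : ℝ) - 2) *
      ∑ i, ∑ j, ricci (g.coord x₀) i j (coordCurve n x₀ γ t) *
        deriv (coordCurve n x₀ γ) t i * deriv (coordCurve n x₀ γ) t j) t

theorem contDiffAt_coordCurve {γ : ℝ → M} {I : Set ℝ} (hI : IsOpen I)
    (hγ : ContMDiffOn 𝓘(ℝ, ℝ) (𝓡 n) ∞ γ I) {x₀ : M} {t : ℝ} (ht : t ∈ I)
    (hs : γ t ∈ (extChartAt (𝓡 n) x₀).source) : ContDiffAt ℝ ∞ (coordCurve n x₀ γ) t := by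
  have h1 : ContMDiffAt 𝓘(ℝ, ℝ) (𝓡 n) ∞ γ t := hγ.contMDiffAt (hI.mem_nhds ht)
  have h2 : ContMDiffAt (𝓡 n) 𝓘(ℝ, EuclideanSpace ℝ (Fin n)) ∞ (extChartAt (𝓡 n) x₀) (γ t) :=
    contMDiffAt_extChartAt' (by simpa using hs)
  exact (h2.comp t h1).contDiffAt

omit [IsManifold (𝓡 n) ∞ M] in
theorem eventually_mem_source {γ : ℝ → M} {I : Set ℝ} (hI : IsOpen I)
    (hγ : ContMDiffOn 𝓘(ℝ, ℝ) (𝓡 n) ∞ γ I) {x₀ : M} {t : ℝ} (ht : t ∈ I)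
    (hs : γ t ∈ (extChartAt (𝓡 n) x₀).source) :
    ∀ᶠ s in 𝓝 t, s ∈ I ∧ γ s ∈ (extChartAt (𝓡 n) x₀).source :=
  Filter.Eventually.and (hI.mem_nhds ht) ((hγ.contMDiffAt (hI.mem_nhds ht)).continuousAt.eventually
    ((isOpen_extChartAt_source x₀).mem_nhds hs))

theorem sum_sum_smul (B : Fin n → Fin n → ℝ) (c : ℝ) (v : EuclideanSpace ℝ (Fin n)) :
    ∑ i, ∑ j, B i j * (c • v) i * (c • v) j = c ^ 2 * ∑ i, ∑ j, B i j * v i * v j := by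
  simp only [Finset.mul_sum]
  refine Finset.sum_congr rfl fun i _ ↦ Finset.sum_congr rfl fun j _ ↦ ?_
  simp only [PiLp.smul_apply, smul_eq_mul]
  ring

/-- With `τ = u⁻¹`, so that `γ = ξ ∘ τ`, the function is `φ = τ'' / τ'`. The Schwarzian equation for
`u` is equivalent to the Riccati equation for `φ`. -/
theorem PseudoMetric.IsPPL.exists_projGeodesicOn {g : PseudoMetric n M} {γ : ℝ → M} {I : Set ℝ}
    (hI : IsOpen I) (h : g.IsPPL I γ) : ∃ φ, ProjGeodesicOn g γ φ I := by
  obtain ⟨J, ξ, u, hJ, -, hξ, hu, hbij, hγ⟩ := h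
  obtain ⟨hu1, hu2, hu3⟩ := hu
  set τ := Function.invFunOn u J with hτdef
  have hinv := hbij.invOn_invFunOn
  have hτJ : ∀ s ∈ I, τ s ∈ J := fun s hs ↦ hbij.surjOn.mapsTo_invFunOn hs
  have huτ : ∀ s ∈ I, u (τ s) = s := fun s hs ↦ hinv.2 hs
  have hτu : ∀ t ∈ J, τ (u t) = t := fun t ht ↦ hinv.1 ht
  have hγξ : ∀ s ∈ I, γ s = ξ (τ s) := fun s hs ↦ by rw [← hγ _ (hτJ s hs), huτ s hs]
  have hτ' {s : ℝ} (hs : s ∈ I) : HasDerivAt τ (deriv u (τ s))⁻¹ s :=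
    hasDerivAt_of_bijOn hJ hu1 hu2 hτJ hτu huτ hs
  have hτsm := contDiffOn_of_bijOn hJ hI hu1 hu2 hτJ hτu huτ
  have hud {t : ℝ} (ht : t ∈ J) : HasDerivAt (deriv u) (deriv (deriv u) t) t :=
    (((contDiffOn_infty_iff_deriv_of_isOpen hJ).1 hu1).2.contDiffAt
      (hJ.mem_nhds ht)).differentiableAt (by simp) |>.hasDerivAt
  have hudd {t : ℝ} (ht : t ∈ J) : DifferentiableAt ℝ (deriv (deriv u)) t :=
    (((contDiffOn_infty_iff_deriv_of_isOpen hJ).1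
      ((contDiffOn_infty_iff_deriv_of_isOpen hJ).1 hu1).2).2.contDiffAt
      (hJ.mem_nhds ht)).differentiableAt (by simp)
  have hz (x₀ : M) {s : ℝ} (hs : s ∈ I) :
      coordCurve n x₀ γ =ᶠ[𝓝 s] fun s ↦ coordCurve n x₀ ξ (τ s) := by
    filter_upwards [hI.mem_nhds hs] with r hr
    rw [coordCurve, coordCurve, hγξ r hr]
  have hd1 (x₀ : M) {s : ℝ} (hs : s ∈ I) (hc : γ s ∈ (extChartAt (𝓡 n) x₀).source) :
      deriv (coordCurve n x₀ γ) s = (deriv u (τ s))⁻¹ • deriv (coordCurve n x₀ ξ) (τ s) :=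
    deriv_comp_eq ((contDiffAt_coordCurve hJ hξ.1 (hτJ s hs)
      (hγξ s hs ▸ hc)).differentiableAt (by simp)) (hτ' hs) (hz x₀ hs)
  have hd2 (x₀ : M) {s : ℝ} (hs : s ∈ I) (hc : γ s ∈ (extChartAt (𝓡 n) x₀).source) :=
    deriv_deriv_comp_eq (contDiffAt_coordCurve hJ hξ.1 (hτJ s hs) (hγξ s hs ▸ hc))
      (by filter_upwards [hI.mem_nhds hs] with r hr using hτ' hr)
      (hud (hτJ s hs)) (hu2 _ (hτJ s hs)) (hz x₀ hs)
  -- This is `τ'' / τ'` expressed through `u`.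
  refine ⟨fun s ↦ -(deriv (deriv u) (τ s) / deriv u (τ s)) * (deriv u (τ s))⁻¹, ?_, ?_, ?_, ?_⟩
  · exact (hξ.1.comp hτsm.contMDiffOn hτJ).congr hγξ
  · intro x₀ s hs hc
    have h := (hξ.2 x₀ (τ s) (hτJ s hs) (hγξ s hs ▸ hc)).1
    rw [hd1 x₀ hs hc, sum_sum_smul fun i j ↦ g.coord x₀ _ i j, (hz x₀ hs).self_of_nhds, h, mul_zero]
  · intro x₀ s hs hc k
    have h := (hξ.2 x₀ (τ s) (hτJ s hs) (hγξ s hs ▸ hc)).2 k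
    rw [hd1 x₀ hs hc, hd2 x₀ hs hc, sum_sum_smul fun i j ↦ christoffel _ _ _ _ _,
      (hz x₀ hs).self_of_nhds]
    simp only [PiLp.sub_apply, PiLp.smul_apply, smul_eq_mul]
    rw [eq_neg_of_add_eq_zero_left h]
    ring
  · intro x₀ s hs hc
    have h := hu3 x₀ (τ s) (hτJ s hs) (hγξ s hs ▸ hc)
    have hne := hu2 _ (hτJ s hs)
    rw [hd1 x₀ hs hc, sum_sum_smul fun i j ↦ ricci _ _ _ _, (hz x₀ hs).self_of_nhds]
    have hq : HasDerivAt (fun t ↦ deriv (deriv u) t / deriv u t)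
        (deriv (fun t ↦ deriv (deriv u) t / deriv u t) (τ s)) (τ s) :=
      ((hudd (hτJ s hs)).fun_div (hud (hτJ s hs)).differentiableAt hne).hasDerivAt
    have h1 := ((hq.comp s (hτ' hs)).fun_neg).fun_mul
      (((hud (hτJ s hs)).comp s (hτ' hs)).fun_inv hne)
    convert! h1 using 1
    rw [mul_left_comm, ← h, schwarzian]
    simp only [Function.comp_apply]
    field_simp
    ring

end

/-! ### Affine changes of parameter and conformal invariance. -/

section

variable {n : ℕ} {M : Type*} [TopologicalSpace M]
  [ChartedSpace (EuclideanSpace ℝ (Fin n)) M] [IsManifold (𝓡 n) ∞ M]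

/-- Affine changes of the parameter. -/
theorem ProjGeodesicOn.comp_affine {g : PseudoMetric n M} {γ : ℝ → M} {φ : ℝ → ℝ} {I I' : Set ℝ}
    (h : ProjGeodesicOn g γ φ I) (hI : IsOpen I) {a b : ℝ} (hb : b ≠ 0)
    (hmaps : ∀ t ∈ I', a + b * t ∈ I) :
    ProjGeodesicOn g (fun t ↦ γ (a + b * t)) (fun t ↦ b * φ (a + b * t)) I' := by
  have hτ (s : ℝ) : HasDerivAt (fun t ↦ a + b * t) b s := by
    simpa using ((hasDerivAt_id s).const_mul b).const_add a
  have hτ' (s : ℝ) : HasDerivAt (fun t ↦ a + b * t) ((fun _ ↦ b⁻¹) (a + b * s))⁻¹ s := by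
    simpa using hτ s
  have hd1 (x₀ : M) {s : ℝ} (hs : s ∈ I')
      (hc : γ (a + b * s) ∈ (extChartAt (𝓡 n) x₀).source) :
      deriv (coordCurve n x₀ fun t ↦ γ (a + b * t)) s =
        b • deriv (coordCurve n x₀ γ) (a + b * s) := by
    have := deriv_comp_eq (τ := fun t ↦ a + b * t) (p := fun _ ↦ b⁻¹) ((contDiffAt_coordCurve hI h.contMDiffOn (hmaps s hs)
      hc).differentiableAt (by simp)) (hτ' s)
      (EventuallyEq.refl (𝓝 s) (coordCurve n x₀ fun t ↦ γ (a + b * t)))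
    simpa using this
  have hd2 (x₀ : M) {s : ℝ} (hs : s ∈ I')
      (hc : γ (a + b * s) ∈ (extChartAt (𝓡 n) x₀).source) :
      deriv (deriv (coordCurve n x₀ fun t ↦ γ (a + b * t))) s =
        b ^ 2 • deriv (deriv (coordCurve n x₀ γ)) (a + b * s) := by
    have := deriv_deriv_comp_eq (τ := fun t ↦ a + b * t) (p := fun _ ↦ b⁻¹)
      (contDiffAt_coordCurve hI h.contMDiffOn (hmaps s hs) hc)
      (Eventually.of_forall hτ') (hasDerivAt_const _ _) (inv_ne_zero hb)
      (EventuallyEq.refl (𝓝 s) (coordCurve n x₀ fun t ↦ γ (a + b * t)))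
    simpa using this
  have hy (x₀ : M) (s : ℝ) : coordCurve n x₀ (fun t ↦ γ (a + b * t)) s =
      coordCurve n x₀ γ (a + b * s) := rfl
  constructor
  · have h1 : ContDiff ℝ ∞ fun t : ℝ ↦ a + b * t := by fun_prop
    exact h.contMDiffOn.comp h1.contMDiff.contMDiffOn hmaps
  · intro x₀ s hs hc
    rw [hd1 x₀ hs hc, sum_sum_smul fun i j ↦ g.coord x₀ _ i j, hy, h.null x₀ (hmaps s hs) hc,
      mul_zero]
  · intro x₀ s hs hc k
    have h1 := h.accel x₀ (hmaps s hs) hc k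
    rw [hd1 x₀ hs hc, hd2 x₀ hs hc, sum_sum_smul fun i j ↦ christoffel _ _ _ _ _, hy]
    simp only [PiLp.smul_apply, smul_eq_mul]
    linear_combination b ^ 2 * h1
  · intro x₀ s hs hc
    have h1 := ((h.riccati x₀ (hmaps s hs) hc).comp s (hτ s)).const_mul b
    rw [hd1 x₀ hs hc, sum_sum_smul fun i j ↦ ricci _ _ _ _, hy]
    convert! h1 using 1
    ring

theorem PseudoMetric.coord_conformal {g h : PseudoMetric n M} {f : M → ℝ}
    (H : ∀ (x : M) (v w : TangentSpace (𝓡 n) x), h.form x v w = Real.exp (f x) * g.form x v w)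
    (x₀ : M) (y : EuclideanSpace ℝ (Fin n)) (i j : Fin n) :
    h.coord x₀ y i j = Real.exp (f ((extChartAt (𝓡 n) x₀).symm y)) * g.coord x₀ y i j :=
  H _ _ _

/-- Conformal invariance of projectively parametrized lightlike geodesics. -/
theorem ProjGeodesicOn.conformal {g h : PseudoMetric n M} (hn : (n : ℝ) - 2 ≠ 0) {f : M → ℝ}
    (hf : ContMDiff (𝓡 n) 𝓘(ℝ, ℝ) ∞ f)
    (H : ∀ (x : M) (v w : TangentSpace (𝓡 n) x), h.form x v w = Real.exp (f x) * g.form x v w)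
    {γ : ℝ → M} {φ : ℝ → ℝ} {I : Set ℝ} (hI : IsOpen I) (hγ : ProjGeodesicOn h γ φ I) :
    ProjGeodesicOn g γ (fun t ↦ φ t - deriv (fun s ↦ f (γ s)) t) I := by
  set F : M → EuclideanSpace ℝ (Fin n) → ℝ := fun x₀ y ↦ f ((extChartAt (𝓡 n) x₀).symm y) with hF
  have hFs (x₀ : M) : ContDiffOn ℝ ∞ (F x₀) (extChartAt (𝓡 n) x₀).target :=
    contMDiffOn_iff_contDiffOn.1 (hf.comp_contMDiffOn (contMDiffOn_extChartAt_symm x₀))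
  have hG (x₀ : M) := g.smoothMetricOn_coord x₀
  have hconf (x₀ : M) : ∀ y ∈ (extChartAt (𝓡 n) x₀).target, ∀ i j,
      h.coord x₀ y i j = Real.exp (F x₀ y) * g.coord x₀ y i j :=
    fun y _ i j ↦ PseudoMetric.coord_conformal H x₀ y i j
  have hmem (x₀ : M) {t : ℝ} (hs : γ t ∈ (extChartAt (𝓡 n) x₀).source) :
      coordCurve n x₀ γ t ∈ (extChartAt (𝓡 n) x₀).target := (extChartAt (𝓡 n) x₀).map_source hs
  have hnull (x₀ : M) {t : ℝ} (ht : t ∈ I) (hs : γ t ∈ (extChartAt (𝓡 n) x₀).source) :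
      ∑ i, ∑ j, g.coord x₀ (coordCurve n x₀ γ t) i j *
        deriv (coordCurve n x₀ γ) t i * deriv (coordCurve n x₀ γ) t j = 0 := by
    have h1 := hγ.null x₀ ht hs
    simp only [hconf x₀ _ (hmem x₀ hs), mul_assoc, ← Finset.mul_sum] at h1
    simpa [mul_assoc] using h1
  have hf1 (x₀ : M) {t : ℝ} (ht : t ∈ I) (hs : γ t ∈ (extChartAt (𝓡 n) x₀).source) :
      deriv (fun s ↦ f (γ s)) t = ∑ i, partialDeriv i (F x₀) (coordCurve n x₀ γ t) *
        deriv (coordCurve n x₀ γ) t i := by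
    have h1 := hasDerivAt_comp_curve ((hG x₀).differentiableAt_of (hFs x₀) (hmem x₀ hs))
      ((contDiffAt_coordCurve hI hγ.contMDiffOn ht hs).differentiableAt (by simp)).hasDerivAt
    rw [← h1.deriv]
    refine EventuallyEq.deriv_eq ?_
    filter_upwards [eventually_mem_source hI hγ.contMDiffOn ht hs] with s hs
    simp only [hF, coordCurve]
    rw [(extChartAt (𝓡 n) x₀).left_inv hs.2]
  -- On the null velocity the two connections differ by `df(γ') γ'`, which is absorbed into `φ`.
  have haccel (x₀ : M) {t : ℝ} (ht : t ∈ I) (hs : γ t ∈ (extChartAt (𝓡 n) x₀).source) (k : Fin n) :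
      deriv (deriv (coordCurve n x₀ γ)) t k +
      ∑ i, ∑ j, christoffel (g.coord x₀) k i j (coordCurve n x₀ γ t) *
        deriv (coordCurve n x₀ γ) t i * deriv (coordCurve n x₀ γ) t j =
      (φ t - deriv (fun s ↦ f (γ s)) t) * deriv (coordCurve n x₀ γ) t k := by
    have h1 := hγ.accel x₀ ht hs k
    simp only [christoffel_conformal (hG x₀) (hFs x₀) (hconf x₀) (hmem x₀ hs), add_mul,
      Finset.sum_add_distrib] at h1
    rw [conformalShift_null (v := fun i ↦ deriv (coordCurve n x₀ γ) t i) (hnull x₀ ht hs)] at h1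
    rw [hf1 x₀ ht hs]
    linear_combination h1
  refine ⟨hγ.contMDiffOn, hnull, haccel, ?_⟩
  intro x₀ t ht hs
  have hy := contDiffAt_coordCurve hI hγ.contMDiffOn ht hs
  have hv (i : Fin n) : HasDerivAt (fun s ↦ deriv (coordCurve n x₀ γ) s i)
      (deriv (deriv (coordCurve n x₀ γ)) t i) t :=
    (EuclideanSpace.proj (𝕜 := ℝ) i).hasFDerivAt.comp_hasDerivAt t
      ((contDiffAt_deriv hy).differentiableAt (by simp)).hasDerivAt
  have hff : HasDerivAt (deriv fun s ↦ f (γ s))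
      (∑ i, ((∑ j, partialDeriv j (partialDeriv i (F x₀)) (coordCurve n x₀ γ t) *
        deriv (coordCurve n x₀ γ) t j) * deriv (coordCurve n x₀ γ) t i +
        partialDeriv i (F x₀) (coordCurve n x₀ γ t) * deriv (deriv (coordCurve n x₀ γ)) t i)) t := by
    have h1 := HasDerivAt.fun_sum (u := Finset.univ) fun i _ ↦ (hasDerivAt_comp_curve
      ((hG x₀).differentiableAt_of (contDiffOn_partialDeriv (hG x₀).isOpen (hFs x₀) i) (hmem x₀ hs))
      (hy.differentiableAt (by simp)).hasDerivAt).fun_mul (hv i)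
    refine h1.congr_of_eventuallyEq ?_
    filter_upwards [eventually_mem_source hI hγ.contMDiffOn ht hs] with s hs
    exact hf1 x₀ hs.1 hs.2
  have h2 := (hγ.riccati x₀ ht hs).fun_sub hff
  convert! h2 using 1
  rw [ricci_conformal (v := fun i ↦ deriv (coordCurve n x₀ γ) t i) (hG x₀) (hFs x₀) (hconf x₀)
    (hmem x₀ hs) (hnull x₀ ht hs)]
  have hacc (k : Fin n) := eq_sub_of_add_eq (haccel x₀ ht hs k)
  simp only [hacc]
  rw [← hf1 x₀ ht hs]
  set v := deriv (coordCurve n x₀ γ) t with hvdef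
  -- By the geodesic equation, `(f ∘ γ)'' = Hess f(γ', γ') + (φ - (f ∘ γ)') * (f ∘ γ)'`. The Hessian
  -- then cancels the one coming from the Ricci tensor, since `2 / (n - 2)` and `(n - 2) / 2` are
  -- inverse to each other.
  have e1 : ∑ i, ((∑ j, partialDeriv j (partialDeriv i (F x₀)) (coordCurve n x₀ γ t) * v j) * v i +
      partialDeriv i (F x₀) (coordCurve n x₀ γ t) * ((φ t - deriv (fun s ↦ f (γ s)) t) * v i -
        ∑ i_1, ∑ j, christoffel (g.coord x₀) i i_1 j (coordCurve n x₀ γ t) * v i_1 * v j)) =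
      ∑ i, ∑ j, partialDeriv i (partialDeriv j (F x₀)) (coordCurve n x₀ γ t) * v i * v j +
      (φ t - deriv (fun s ↦ f (γ s)) t) * deriv (fun s ↦ f (γ s)) t -
      ∑ k, partialDeriv k (F x₀) (coordCurve n x₀ γ t) *
        (∑ i, ∑ j, christoffel (g.coord x₀) k i j (coordCurve n x₀ γ t) * v i * v j) := by
    rw [hf1 x₀ ht hs]
    simp only [mul_sub, Finset.sum_sub_distrib, Finset.sum_add_distrib, Finset.sum_mul,
      Finset.mul_sum]
    rw [Finset.sum_comm, ← add_sub_assoc]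
    congr 2
    exact Finset.sum_congr rfl fun i _ ↦ by ring
  rw [e1]
  field_simp
  ring

end

/-! ### From the differential system back to projectively parametrized geodesics. -/

section

/-- An increasing diffeomorphism `τ` of the line onto an open interval with `τ'' = φ τ'`. -/
theorem exists_reparametrization {φ : ℝ → ℝ} (hφ : ContDiff ℝ ∞ φ) :
    ∃ τ q : ℝ → ℝ, ContDiff ℝ ∞ τ ∧ (∀ s, HasDerivAt τ (q s) s) ∧ (∀ s, 0 < q s) ∧
      ∀ s, HasDerivAt q (φ s * q s) s := by
  have hΦ (s : ℝ) : HasDerivAt (fun s ↦ ∫ x in (0 : ℝ)..s, φ x) (φ s) s :=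
    intervalIntegral.integral_hasDerivAt_right (hφ.continuous.intervalIntegrable _ _)
      (hφ.continuous.stronglyMeasurableAtFilter _ _) hφ.continuous.continuousAt
  set q : ℝ → ℝ := fun s ↦ Real.exp (∫ x in (0 : ℝ)..s, φ x) with hq
  have hq' (s : ℝ) : HasDerivAt q (φ s * q s) s := by
    simpa [mul_comm] using (hΦ s).exp
  have hqc : Continuous q := continuous_iff_continuousAt.2 fun s ↦ (hq' s).continuousAt
  have hτ (s : ℝ) : HasDerivAt (fun s ↦ ∫ x in (0 : ℝ)..s, q x) (q s) s :=
    intervalIntegral.integral_hasDerivAt_right (hqc.intervalIntegrable _ _)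
      (hqc.stronglyMeasurableAtFilter _ _) hqc.continuousAt
  have smooth_of {a b : ℝ → ℝ} (hb : ContDiff ℝ ∞ b) (h : ∀ s, HasDerivAt a (b s) s) :
      ContDiff ℝ ∞ a := by
    rw [contDiff_infty_iff_deriv]
    exact ⟨fun s ↦ (h s).differentiableAt, by rwa [funext fun s ↦ (h s).deriv]⟩
  exact ⟨_, q, smooth_of (Real.contDiff_exp.comp (smooth_of hφ hΦ)) hτ, hτ,
    fun s ↦ Real.exp_pos _, hq'⟩

variable {n : ℕ} {M : Type*} [TopologicalSpace M]
  [ChartedSpace (EuclideanSpace ℝ (Fin n)) M] [IsManifold (𝓡 n) ∞ M]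

/-- Solving `τ'' = φ τ'` yields an affine parameter `τ`. Its range may be a proper interval `J`;
there `u = τ⁻¹` is a projective parameter along the affine geodesic `γ ∘ u`. -/
theorem ProjGeodesicOn.isPPL_univ {g : PseudoMetric n M} {γ : ℝ → M} {φ : ℝ → ℝ}
    (h : ProjGeodesicOn g γ φ univ) (hφ : ContDiff ℝ ∞ φ) : g.IsPPL univ γ := by
  obtain ⟨τ, q, hτ, hτq, hq0, hq⟩ := exists_reparametrization hφ
  have hmono : StrictMono τ := strictMono_of_hasDerivAt_pos hτq hq0
  have hopen : IsOpen (range τ) :=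
    (isOpenMap_of_hasStrictDerivAt (fun s ↦ ((hτ.contDiffAt (x := s)).hasStrictDerivAt' (hτq s)
      (by simp))) fun s ↦ (hq0 s).ne').isOpen_range
  set u := Function.invFun τ with hu
  have huτ (s : ℝ) : u (τ s) = s := Function.leftInverse_invFun hmono.injective s
  have hτu : ∀ t ∈ range τ, τ (u t) = t := by
    rintro _ ⟨s, rfl⟩
    rw [huτ]
  have hderiv : deriv τ = q := funext fun s ↦ (hτq s).deriv
  have hu' {t : ℝ} (ht : t ∈ range τ) : HasDerivAt u (q (u t))⁻¹ t := by
    have := hasDerivAt_of_bijOn (I := range τ) isOpen_univ hτ.contDiffOn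
      (fun s _ ↦ by rw [hderiv]; exact (hq0 s).ne') (fun _ _ ↦ mem_univ _) (fun s _ ↦ huτ s) hτu ht
    rwa [hderiv] at this
  have husm : ContDiffOn ℝ ∞ u (range τ) :=
    contDiffOn_of_bijOn isOpen_univ hopen hτ.contDiffOn
      (fun s _ ↦ by rw [hderiv]; exact (hq0 s).ne') (fun _ _ ↦ mem_univ _) (fun s _ ↦ huτ s) hτu
  have hd1 (x₀ : M) {t : ℝ} (ht : t ∈ range τ) (hc : γ (u t) ∈ (extChartAt (𝓡 n) x₀).source) :
      deriv (coordCurve n x₀ fun t ↦ γ (u t)) t = (q (u t))⁻¹ • deriv (coordCurve n x₀ γ) (u t) :=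
    deriv_comp_eq ((contDiffAt_coordCurve isOpen_univ h.contMDiffOn (mem_univ _)
      hc).differentiableAt (by simp)) (hu' ht) EventuallyEq.rfl
  have hd2 (x₀ : M) {t : ℝ} (ht : t ∈ range τ) (hc : γ (u t) ∈ (extChartAt (𝓡 n) x₀).source) :=
    deriv_deriv_comp_eq (z := coordCurve n x₀ fun t ↦ γ (u t))
      (contDiffAt_coordCurve isOpen_univ h.contMDiffOn (mem_univ _) hc)
      (by filter_upwards [hopen.mem_nhds ht] with r hr using hu' hr)
      (hq (u t)) (hq0 _).ne' EventuallyEq.rfl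
  have hy (x₀ : M) (t : ℝ) : coordCurve n x₀ (fun t ↦ γ (u t)) t = coordCurve n x₀ γ (u t) := rfl
  refine ⟨range τ, fun t ↦ γ (u t), u, hopen, (isPreconnected_range hτ.continuous).ordConnected,
    ⟨h.contMDiffOn.comp husm.contMDiffOn fun _ _ ↦ mem_univ _, fun x₀ t ht hc ↦ ⟨?_, fun k ↦ ?_⟩⟩,
    ⟨husm, fun t ht ↦ ?_, fun x₀ t ht hc ↦ ?_⟩, ⟨fun _ _ ↦ mem_univ _, ?_, ?_⟩, fun t _ ↦ rfl⟩
  · rw [hd1 x₀ ht hc, sum_sum_smul fun i j ↦ g.coord x₀ _ i j, hy, h.null x₀ (mem_univ _) hc,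
      mul_zero]
  · have h1 := h.accel x₀ (mem_univ _) hc k
    rw [hd1 x₀ ht hc, hd2 x₀ ht hc, sum_sum_smul fun i j ↦ christoffel _ _ _ _ _, hy]
    simp only [PiLp.sub_apply, PiLp.smul_apply, smul_eq_mul]
    have hne := mul_inv_cancel₀ (hq0 (u t)).ne'
    generalize (q (u t))⁻¹ = r at hne ⊢
    linear_combination r ^ 2 * h1 - φ (u t) * r ^ 2 * deriv (coordCurve n x₀ γ) (u t) k * hne
  · rw [(hu' ht).deriv]
    exact inv_ne_zero (hq0 _).ne'
  · have h1 := h.riccati x₀ (mem_univ (u t)) hc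
    have hne := (hq0 (u t)).ne'
    rw [hd1 x₀ ht hc, sum_sum_smul fun i j ↦ ricci _ _ _ _, hy, schwarzian]
    have hu2 {t : ℝ} (ht : t ∈ range τ) : deriv (deriv u) t / deriv u t =
        -(φ (u t) * (q (u t))⁻¹) := by
      have hne := (hq0 (u t)).ne'
      have e : deriv u =ᶠ[𝓝 t] fun t ↦ (q (u t))⁻¹ := by
        filter_upwards [hopen.mem_nhds ht] with r hr using (hu' hr).deriv
      have h2 := ((hq (u t)).comp t (hu' ht)).fun_inv hne
      rw [e.deriv_eq, e.self_of_nhds]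
      refine (congrArg (· / _) h2.deriv).trans ?_
      simp only [Function.comp_apply]
      field_simp
    have e : (fun s ↦ deriv (deriv u) s / deriv u s) =ᶠ[𝓝 t] fun t ↦ -(φ (u t) * (q (u t))⁻¹) := by
      filter_upwards [hopen.mem_nhds ht] with r hr using hu2 hr
    have h3 := ((h1.comp t (hu' ht)).fun_mul (((hq (u t)).comp t (hu' ht)).fun_inv hne)).fun_neg
    rw [e.deriv_eq, hu2 ht]
    refine (congrArg (· - _) h3.deriv).trans ?_
    simp only [Function.comp_apply]
    field_simp
    ring
  · rintro _ ⟨s, rfl⟩ _ ⟨s', rfl⟩ hss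
    rw [huτ, huτ] at hss
    rw [hss]
  · exact fun s _ ↦ ⟨τ s, ⟨s, rfl⟩, huτ s⟩

end

/-! ### Limits of projectively parametrized geodesics -/

section Limits

variable {ι : Type*}

/-- Ultrafilters replace the extraction of subsequences: all limits below are taken along the same
one. -/
theorem exists_tendsto_of_bounded {F : Type*} [NormedAddCommGroup F] [ProperSpace F]
    (l : Ultrafilter ι) {f : ι → F} {C : ℝ} (h : ∀ᶠ k in l, ‖f k‖ ≤ C) :
    ∃ L, Tendsto f l (𝓝 L) := by
  obtain ⟨L, -, hL⟩ := (isCompact_closedBall (0 : F) C).ultrafilter_le_nhds (l.map f) (by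
    rw [le_principal_iff, Ultrafilter.mem_coe, Ultrafilter.mem_map]
    filter_upwards [h] with k hk
    simpa using hk)
  exact ⟨L, hL⟩

theorem continuousAt_of_tendsto_prod_nhds {X : Type*} [TopologicalSpace X] [RegularSpace X]
    {l : Filter ι} [NeBot l] {f : ι → ℝ → X} {g : ℝ → X} {t : ℝ}
    (h : Tendsto (fun p : ι × ℝ ↦ f p.1 p.2) (l ×ˢ 𝓝 t) (𝓝 (g t)))
    (hg : ∀ s, Tendsto (fun k ↦ f k s) l (𝓝 (g s))) : ContinuousAt g t := by
  refine (closed_nhds_basis (g t)).tendsto_right_iff.2 fun V hV ↦ ?_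
  obtain ⟨A, hA, B, hB, hAB⟩ := eventually_prod_iff.1 (h.eventually hV.1)
  filter_upwards [hB] with s hs
  exact hV.2.mem_of_tendsto (hg s) (hA.mono fun k hk ↦ hAB hk hs)

variable {n N : ℕ} {M : Type*} [TopologicalSpace M]
  [ChartedSpace (EuclideanSpace ℝ (Fin n)) M] [IsManifold (𝓡 n) ∞ M]

theorem hasDerivAt_euclidean {c : ℝ → EuclideanSpace ℝ (Fin n)} {c' : EuclideanSpace ℝ (Fin n)}
    {t : ℝ} (h : ∀ i, HasDerivAt (fun s ↦ c s i) (c' i) t) : HasDerivAt c c' t :=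
  (EuclideanSpace.equiv (Fin n) ℝ).symm.hasFDerivAt.comp_hasDerivAt t (hasDerivAt_pi.2 h)

/-- An immersion read in the chart at `x₀`. -/
def chartMap (e : M → EuclideanSpace ℝ (Fin N)) (x₀ : M) (y : EuclideanSpace ℝ (Fin n)) :
    EuclideanSpace ℝ (Fin N) :=
  e ((extChartAt (𝓡 n) x₀).symm y)

theorem contDiffOn_chartMap {e : M → EuclideanSpace ℝ (Fin N)} (he : ContMDiff (𝓡 n) (𝓡 N) ∞ e)
    (x₀ : M) : ContDiffOn ℝ ∞ (chartMap e x₀) (extChartAt (𝓡 n) x₀).target :=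
  contMDiffOn_iff_contDiffOn.1 (he.comp_contMDiffOn (contMDiffOn_extChartAt_symm x₀))

theorem injective_fderiv_chartMap {e : M → EuclideanSpace ℝ (Fin N)}
    (he : ContMDiff (𝓡 n) (𝓡 N) ∞ e) (hinj : ∀ x, Function.Injective (mfderiv (𝓡 n) (𝓡 N) e x))
    (x₀ : M) {y : EuclideanSpace ℝ (Fin n)} (hy : y ∈ (extChartAt (𝓡 n) x₀).target) :
    Function.Injective (fderiv ℝ (chartMap e x₀) y) := by
  have hinv := isInvertible_mfderivWithin_extChartAt_symm (I := 𝓡 n) hy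
  rw [modelWithCornersSelf_coe, range_id, mfderivWithin_univ] at hinv
  have hd : MDifferentiableAt (𝓡 n) (𝓡 n) (extChartAt (𝓡 n) x₀).symm y :=
    ((contMDiffOn_extChartAt_symm (n := ∞) x₀).contMDiffAt
      ((isOpen_extChartAt_target x₀).mem_nhds hy)).mdifferentiableAt (by simp)
  have h := mfderiv_comp y (he.mdifferentiableAt (by simp)) hd
  rw [← mfderiv_eq_fderiv]
  change Function.Injective (mfderiv (𝓡 n) (𝓡 N) (e ∘ (extChartAt (𝓡 n) x₀).symm) y)
  rw [h]
  exact (hinj _).comp hinv.bijective.1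

theorem deriv_comp_eq_fderiv_chartMap {e : M → EuclideanSpace ℝ (Fin N)}
    (he : ContMDiff (𝓡 n) (𝓡 N) ∞ e) {γ : ℝ → M} {I : Set ℝ} (hI : IsOpen I)
    (hγ : ContMDiffOn 𝓘(ℝ, ℝ) (𝓡 n) ∞ γ I) {x₀ : M} {t : ℝ} (ht : t ∈ I)
    (hs : γ t ∈ (extChartAt (𝓡 n) x₀).source) :
    deriv (fun s ↦ e (γ s)) t =
      fderiv ℝ (chartMap e x₀) (coordCurve n x₀ γ t) (deriv (coordCurve n x₀ γ) t) := by
  have h1 : (fun s ↦ e (γ s)) =ᶠ[𝓝 t] fun s ↦ chartMap e x₀ (coordCurve n x₀ γ s) := by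
    filter_upwards [eventually_mem_source hI hγ ht hs] with s hs
    rw [chartMap, coordCurve, (extChartAt (𝓡 n) x₀).left_inv hs.2]
  have hmem : coordCurve n x₀ γ t ∈ (extChartAt (𝓡 n) x₀).target :=
    (extChartAt (𝓡 n) x₀).map_source hs
  have h2 : DifferentiableAt ℝ (chartMap e x₀) (coordCurve n x₀ γ t) :=
    ((contDiffOn_chartMap he x₀).contDiffAt
      ((isOpen_extChartAt_target x₀).mem_nhds hmem)).differentiableAt (by simp)
  rw [h1.deriv_eq]
  exact (h2.hasFDerivAt.comp_hasDerivAt t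
    ((contDiffAt_coordCurve hI hγ ht hs).differentiableAt (by simp)).hasDerivAt).deriv

omit [IsManifold (𝓡 n) ∞ M] in
theorem contDiffAt_embedding_comp {e : M → EuclideanSpace ℝ (Fin N)}
    (he : ContMDiff (𝓡 n) (𝓡 N) ∞ e) {γ : ℝ → M} {I : Set ℝ} (hI : IsOpen I)
    (hγ : ContMDiffOn 𝓘(ℝ, ℝ) (𝓡 n) ∞ γ I) {t : ℝ} (ht : t ∈ I) :
    ContDiffAt ℝ ∞ (fun s ↦ e (γ s)) t :=
  ((he.contMDiffAt).comp t (hγ.contMDiffAt (hI.mem_nhds ht))).contDiffAt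

/-- An injective linear map is uniformly bounded below, also after a small perturbation. -/
theorem eventually_antilipschitz {E F X : Type*} [NormedAddCommGroup E] [NormedSpace ℝ E]
    [FiniteDimensional ℝ E] [NormedAddCommGroup F] [NormedSpace ℝ F] [TopologicalSpace X]
    {D : X → E →L[ℝ] F} {x : X} (hD : ContinuousAt D x) (hinj : Function.Injective (D x)) :
    ∃ C : ℝ, 0 < C ∧ ∀ᶠ z in 𝓝 x, ∀ v, ‖v‖ ≤ C * ‖D z v‖ := by
  obtain ⟨K, hK, hanti⟩ := (D x).toLinearMap.exists_antilipschitzWith (LinearMap.ker_eq_bot.2 hinj)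
  have hK' : (0 : ℝ) < K := by exact_mod_cast hK
  -- A perturbation of norm at most `1 / (2 * K)` costs `‖v‖ / 2`, which is absorbed by doubling the
  -- constant.
  refine ⟨2 * K, by positivity, ?_⟩
  filter_upwards [Metric.tendsto_nhds.1 hD (1 / (2 * K)) (by positivity)] with z hz v
  have h1 : ‖v‖ ≤ K * ‖D x v‖ := by
    simpa using hanti.le_mul_dist v 0
  have h2 : ‖D x v‖ ≤ ‖D z v‖ + 1 / (2 * K) * ‖v‖ := by
    have h3 : ‖(D z - D x) v‖ ≤ 1 / (2 * K) * ‖v‖ :=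
      (ContinuousLinearMap.le_opNorm _ _).trans
        (mul_le_mul_of_nonneg_right (by rw [← dist_eq_norm]; exact hz.le) (norm_nonneg _))
    have h4 : D x v = D z v - (D z - D x) v := by simp
    rw [h4]
    exact (norm_sub_le _ _).trans (by linarith)
  have h5 : ‖v‖ ≤ K * ‖D z v‖ + 1 / 2 * ‖v‖ := by
    refine h1.trans ((mul_le_mul_of_nonneg_left h2 hK'.le).trans (le_of_eq ?_))
    field_simp
  linarith

/-- A family of projectively parametrized geodesics with bounded speeds, converging locally
uniformly to a curve defined on the whole line. -/
structure ConvergingFamily (l : Filter ι) (gk : ι → PseudoMetric n M) (g : PseudoMetric n M)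
    (γk : ι → ℝ → M) (φk : ι → ℝ → ℝ) (Ik : ι → Set ℝ) (γ : ℝ → M)
    (e : M → EuclideanSpace ℝ (Fin N)) : Prop where
  tendsto_metric : Tendsto gk l (𝓝 g)
  isOpen (k : ι) : IsOpen (Ik k)
  sol (k : ι) : ProjGeodesicOn (gk k) (γk k) (φk k) (Ik k)
  eventually_mem (t : ℝ) : ∀ᶠ p : ι × ℝ in l ×ˢ 𝓝 t, p.2 ∈ Ik p.1
  smooth : ContMDiff (𝓡 n) (𝓡 N) ∞ e
  injective (x : M) : Function.Injective (mfderiv (𝓡 n) (𝓡 N) e x)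
  speed_le (k : ι) {t : ℝ} (ht : t ∈ Ik k) : ‖deriv (fun s ↦ e (γk k s)) t‖ ≤ 2
  tendsto_prod (t : ℝ) : Tendsto (fun p : ι × ℝ ↦ γk p.1 p.2) (l ×ˢ 𝓝 t) (𝓝 (γ t))

namespace ConvergingFamily

variable {l : Filter ι} {gk : ι → PseudoMetric n M} {g : PseudoMetric n M} {γk : ι → ℝ → M}
  {φk : ι → ℝ → ℝ} {Ik : ι → Set ℝ} {γ : ℝ → M} {e : M → EuclideanSpace ℝ (Fin N)}
  (h : ConvergingFamily l gk g γk φk Ik γ e)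
include h

theorem tendsto_at (t : ℝ) : Tendsto (fun k ↦ γk k t) l (𝓝 (γ t)) :=
  (h.tendsto_prod t).comp (tendsto_id.prodMk (tendsto_const_nhds.mono_right (le_refl (𝓝 t))))

variable {x₀ : M} {t : ℝ} (hs : γ t ∈ (extChartAt (𝓡 n) x₀).source)
include hs

theorem eventually_source : ∀ᶠ p : ι × ℝ in l ×ˢ 𝓝 t,
    p.2 ∈ Ik p.1 ∧ γk p.1 p.2 ∈ (extChartAt (𝓡 n) x₀).source :=
  (h.eventually_mem t).and
    ((h.tendsto_prod t).eventually ((isOpen_extChartAt_source x₀).mem_nhds hs))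

theorem tendsto_coordCurve : Tendsto (fun p : ι × ℝ ↦ coordCurve n x₀ (γk p.1) p.2) (l ×ˢ 𝓝 t)
    (𝓝 (coordCurve n x₀ γ t)) :=
  (continuousAt_extChartAt' hs).tendsto.comp (h.tendsto_prod t)

theorem tendsto_prodMk_coordCurve :
    Tendsto (fun p : ι × ℝ ↦ (p.1, coordCurve n x₀ (γk p.1) p.2)) (l ×ˢ 𝓝 t)
      (l ×ˢ 𝓝 (coordCurve n x₀ γ t)) :=
  tendsto_fst.prodMk (h.tendsto_coordCurve hs)

theorem tendsto_christoffel (k i j : Fin n) : Tendsto (fun p : ι × ℝ ↦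
    christoffel ((gk p.1).coord x₀) k i j (coordCurve n x₀ (γk p.1) p.2)) (l ×ˢ 𝓝 t)
    (𝓝 (christoffel (g.coord x₀) k i j (coordCurve n x₀ γ t))) := by
  have hy : coordCurve n x₀ γ t ∈ (extChartAt (𝓡 n) x₀).target :=
    (extChartAt (𝓡 n) x₀).map_source hs
  have h1 := (PseudoMetric.tendstoC2At h.tendsto_metric x₀ hy).christoffel
    (g.smoothMetricOn_coord x₀) hy k i j
  have h2 := h1.comp (h.tendsto_prodMk_coordCurve hs)
  exact h2

theorem tendsto_ricci (i j : Fin n) : Tendsto (fun p : ι × ℝ ↦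
    ricci ((gk p.1).coord x₀) i j (coordCurve n x₀ (γk p.1) p.2)) (l ×ˢ 𝓝 t)
    (𝓝 (ricci (g.coord x₀) i j (coordCurve n x₀ γ t))) := by
  have hy : coordCurve n x₀ γ t ∈ (extChartAt (𝓡 n) x₀).target :=
    (extChartAt (𝓡 n) x₀).map_source hs
  have h1 := (PseudoMetric.tendstoC2At h.tendsto_metric x₀ hy).ricci
    (fun k ↦ (gk k).smoothMetricOn_coord x₀) (g.smoothMetricOn_coord x₀) hy i j
  have h2 := h1.comp (h.tendsto_prodMk_coordCurve hs)
  exact h2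

theorem tendsto_coord (i j : Fin n) : Tendsto (fun p : ι × ℝ ↦
    (gk p.1).coord x₀ (coordCurve n x₀ (γk p.1) p.2) i j) (l ×ˢ 𝓝 t)
    (𝓝 (g.coord x₀ (coordCurve n x₀ γ t) i j)) := by
  have hy : coordCurve n x₀ γ t ∈ (extChartAt (𝓡 n) x₀).target :=
    (extChartAt (𝓡 n) x₀).map_source hs
  have h1 := (PseudoMetric.tendstoC2At h.tendsto_metric x₀ hy).zero i j
  have h2 := h1.comp (h.tendsto_prodMk_coordCurve hs)
  exact h2

/-- The differential of the immersion is uniformly bounded below near the limit point, so the bound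
`2` on speeds in `ℝᴺ` bounds coordinate velocities. -/
theorem exists_velocity_bound : ∃ C, ∀ᶠ p : ι × ℝ in l ×ˢ 𝓝 t,
    ‖deriv (coordCurve n x₀ (γk p.1)) p.2‖ ≤ C := by
  have hy : coordCurve n x₀ γ t ∈ (extChartAt (𝓡 n) x₀).target :=
    (extChartAt (𝓡 n) x₀).map_source hs
  have hopen : IsOpen (extChartAt (𝓡 n) x₀).target := isOpen_extChartAt_target x₀
  have hc : ContinuousAt (fderiv ℝ (chartMap e x₀)) (coordCurve n x₀ γ t) :=
    (((contDiffOn_chartMap h.smooth x₀).fderiv_of_isOpen (m := ∞) hopen (by simp)).contDiffAt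
      (hopen.mem_nhds hy)).continuousAt
  obtain ⟨C, hC, hev⟩ := eventually_antilipschitz hc
    (injective_fderiv_chartMap h.smooth h.injective x₀ hy)
  refine ⟨C * 2, ?_⟩
  filter_upwards [h.eventually_source hs, (h.tendsto_coordCurve hs).eventually hev] with p hp hv
  refine (hv _).trans (mul_le_mul_of_nonneg_left ?_ hC.le)
  rw [← deriv_comp_eq_fderiv_chartMap h.smooth (h.isOpen p.1) (h.sol p.1).contMDiffOn hp.1 hp.2]
  exact h.speed_le p.1 hp.1

theorem velocity_isBigO (i : Fin n) :
    (fun p : ι × ℝ ↦ deriv (coordCurve n x₀ (γk p.1)) p.2 i) =O[l ×ˢ 𝓝 t] (fun _ ↦ (1 : ℝ)) := by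
  obtain ⟨C, hC⟩ := h.exists_velocity_bound hs
  refine Asymptotics.IsBigO.of_bound C ?_
  filter_upwards [hC] with p hp
  simpa using (PiLp.norm_apply_le (deriv (coordCurve n x₀ (γk p.1)) p.2) i).trans hp

omit h hs in
theorem isBigO_sum_sum {α : Type*} {l : Filter α} {B : α → Fin n → Fin n → ℝ} {v : α → Fin n → ℝ}
    (hB : ∀ i j, (fun p ↦ B p i j) =O[l] (fun _ ↦ (1 : ℝ)))
    (hv : ∀ i, (fun p ↦ v p i) =O[l] (fun _ ↦ (1 : ℝ))) :
    (fun p ↦ ∑ i, ∑ j, B p i j * v p i * v p j) =O[l] (fun _ ↦ (1 : ℝ)) := by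
  have h1 (i j : Fin n) : (fun p ↦ B p i j * v p i * v p j) =O[l] (fun _ ↦ (1 : ℝ)) := by
    simpa using ((hB i j).mul (hv i)).mul (hv j)
  exact Asymptotics.IsBigO.fun_sum fun i _ ↦ Asymptotics.IsBigO.fun_sum fun j _ ↦ h1 i j

/-- The missing bound on the acceleration: near `t` the Ricci term is bounded by some `A`, and the
solutions exist on a fixed interval around each nearby time, so `riccati_bound` applies. -/
theorem exists_param_bound : ∃ B, ∀ᶠ p : ι × ℝ in l ×ˢ 𝓝 t, |φk p.1 p.2| ≤ B := by
  have hO := (isBigO_sum_sum (fun i j ↦ (h.tendsto_ricci hs i j).isBigO_one ℝ)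
    (h.velocity_isBigO hs)).const_mul_left (2 / ((n : ℝ) - 2))
  obtain ⟨A, hA⟩ := hO.bound
  obtain ⟨P, hP, Q, hQ, hPQ⟩ := eventually_prod_iff.1 (hA.and (h.eventually_source hs))
  obtain ⟨δ, hδ, hball⟩ := Metric.eventually_nhds_iff_ball.1 hQ
  -- Times within `δ / 3` of `t` have a margin `δ / 3` on both sides inside the ball of radius `δ`.
  obtain ⟨B, hB⟩ : ∃ B : ℝ, 4 ≤ B * (δ / 3) ∧ 4 * A < B ^ 2 := by
    refine ⟨12 / δ + |A| + 4, ?_, ?_⟩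
    · have h0 := abs_nonneg A
      have h1 : 12 / δ * (δ / 3) = 4 := by field_simp; norm_num
      have h2 : 0 ≤ (|A| + 4) * (δ / 3) := by positivity
      linarith
    · have h0 := le_abs_self A
      have h1 : 0 < 12 / δ := by positivity
      nlinarith [abs_nonneg A]
  refine ⟨B, ?_⟩
  filter_upwards [hP.prod_mk (Metric.ball_mem_nhds t (by positivity : 0 < δ / 3))] with p hp
  have hsub : ∀ x ∈ Icc (p.2 - δ / 3) (p.2 + δ / 3), x ∈ Metric.ball t δ := fun x hx ↦ by
    have h1 : p.2 ∈ Metric.ball t (δ / 3) := hp.2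
    rw [Real.ball_eq_Ioo] at h1 ⊢
    constructor <;> linarith [hx.1, hx.2, h1.1, h1.2]
  refine riccati_bound (A := A) (by positivity) hB.1 hB.2 (fun x hx ↦
    (h.sol p.1).riccati x₀ (hPQ hp.1 (hball x (hsub x hx))).2.1
      (hPQ hp.1 (hball x (hsub x hx))).2.2) fun x hx ↦ ?_
  have h1 := (hPQ hp.1 (hball x (hsub x hx))).1
  simp only [norm_one, mul_one, Real.norm_eq_abs] at h1
  linarith [le_abs_self (2 / ((n : ℝ) - 2) * ∑ i, ∑ j, ricci ((gk p.1).coord x₀) i j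
    (coordCurve n x₀ (γk p.1) x) * deriv (coordCurve n x₀ (γk p.1)) x i *
      deriv (coordCurve n x₀ (γk p.1)) x j)]

end ConvergingFamily

end Limits

/-! ### The differential system satisfied by the limit. -/

section LimitEquation

variable {ι : Type*} {n N : ℕ} {M : Type*} [TopologicalSpace M]
  [ChartedSpace (EuclideanSpace ℝ (Fin n)) M] [IsManifold (𝓡 n) ∞ M]

namespace ConvergingFamily

variable {l : Ultrafilter ι} {gk : ι → PseudoMetric n M} {g : PseudoMetric n M} {γk : ι → ℝ → M}
  {φk : ι → ℝ → ℝ} {Ik : ι → Set ℝ} {γ : ℝ → M} {e : M → EuclideanSpace ℝ (Fin N)}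

/-- The limits of the velocities and of the functions `φ`. -/
theorem exists_limits (h : ConvergingFamily l gk g γk φk Ik γ e) :
    ∃ (v : M → ℝ → EuclideanSpace ℝ (Fin n)) (φ : ℝ → ℝ),
      (∀ x₀ t, γ t ∈ (extChartAt (𝓡 n) x₀).source →
        Tendsto (fun k ↦ deriv (coordCurve n x₀ (γk k)) t) l (𝓝 (v x₀ t))) ∧
      ∀ t, Tendsto (fun k ↦ φk k t) l (𝓝 (φ t)) := by
  have at_t {P : ι × ℝ → Prop} {t : ℝ} (hP : ∀ᶠ p in (l : Filter ι) ×ˢ 𝓝 t, P p) :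
      ∀ᶠ k in (l : Filter ι), P (k, t) :=
    (tendsto_id.prodMk (tendsto_const_nhds.mono_right (le_refl (𝓝 t)))).eventually hP
  have hv (x₀ : M) (t : ℝ) : ∃ L, γ t ∈ (extChartAt (𝓡 n) x₀).source →
      Tendsto (fun k ↦ deriv (coordCurve n x₀ (γk k)) t) l (𝓝 L) := by
    by_cases hs : γ t ∈ (extChartAt (𝓡 n) x₀).source
    · obtain ⟨C, hC⟩ := h.exists_velocity_bound hs
      obtain ⟨L, hL⟩ := exists_tendsto_of_bounded l (at_t hC)
      exact ⟨L, fun _ ↦ hL⟩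
    -- Outside the chart the velocity is a default value, never used.
    · exact ⟨0, fun hs' ↦ (hs hs').elim⟩
  have hφ (t : ℝ) : ∃ L, Tendsto (fun k ↦ φk k t) l (𝓝 L) := by
    obtain ⟨B, hB⟩ := h.exists_param_bound (mem_extChartAt_source (I := 𝓡 n) (γ t))
    exact exists_tendsto_of_bounded l (at_t hB)
  choose v hv using hv
  choose φ hφ using hφ
  exact ⟨v, φ, hv, hφ⟩

variable (h : ConvergingFamily l gk g γk φk Ik γ e) {v : M → ℝ → EuclideanSpace ℝ (Fin n)}
  {φ : ℝ → ℝ}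
  (hv : ∀ x₀ t, γ t ∈ (extChartAt (𝓡 n) x₀).source →
    Tendsto (fun k ↦ deriv (coordCurve n x₀ (γk k)) t) l (𝓝 (v x₀ t)))
  (hφ : ∀ t, Tendsto (fun k ↦ φk k t) l (𝓝 (φ t)))
  {x₀ : M} {t : ℝ} (hs : γ t ∈ (extChartAt (𝓡 n) x₀).source)

include h

theorem continuous_limit [T2Space M] [CompactSpace M] : Continuous γ :=
  continuous_iff_continuousAt.2 fun t ↦
    continuousAt_of_tendsto_prod_nhds (h.tendsto_prod t) h.tendsto_at

include hs

theorem hasDerivAt_family : ∀ᶠ p : ι × ℝ in (l : Filter ι) ×ˢ 𝓝 t,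
    (∀ i, HasDerivAt (fun s ↦ coordCurve n x₀ (γk p.1) s i)
      (deriv (coordCurve n x₀ (γk p.1)) p.2 i) p.2) ∧
    (∀ i, HasDerivAt (fun s ↦ deriv (coordCurve n x₀ (γk p.1)) s i)
      (φk p.1 p.2 * deriv (coordCurve n x₀ (γk p.1)) p.2 i -
        ∑ a, ∑ b, christoffel ((gk p.1).coord x₀) i a b (coordCurve n x₀ (γk p.1) p.2) *
          deriv (coordCurve n x₀ (γk p.1)) p.2 a * deriv (coordCurve n x₀ (γk p.1)) p.2 b) p.2) ∧
    HasDerivAt (φk p.1) (φk p.1 p.2 ^ 2 / 2 - 2 / ((n : ℝ) - 2) *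
      ∑ a, ∑ b, ricci ((gk p.1).coord x₀) a b (coordCurve n x₀ (γk p.1) p.2) *
        deriv (coordCurve n x₀ (γk p.1)) p.2 a * deriv (coordCurve n x₀ (γk p.1)) p.2 b) p.2 := by
  filter_upwards [h.eventually_source hs] with p hp
  have hy := contDiffAt_coordCurve (h.isOpen p.1) (h.sol p.1).contMDiffOn hp.1 hp.2
  refine ⟨fun i ↦ ?_, fun i ↦ ?_, (h.sol p.1).riccati x₀ hp.1 hp.2⟩
  · exact (EuclideanSpace.proj (𝕜 := ℝ) i).hasFDerivAt.comp_hasDerivAt p.2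
      (hy.differentiableAt (by simp)).hasDerivAt
  · rw [← eq_sub_of_add_eq ((h.sol p.1).accel x₀ hp.1 hp.2 i)]
    exact (EuclideanSpace.proj (𝕜 := ℝ) i).hasFDerivAt.comp_hasDerivAt p.2
      ((contDiffAt_deriv hy).differentiableAt (by simp)).hasDerivAt

theorem param_isBigO : (fun p : ι × ℝ ↦ φk p.1 p.2) =O[(l : Filter ι) ×ˢ 𝓝 t]
    (fun _ ↦ (1 : ℝ)) := by
  obtain ⟨C, hC⟩ := h.exists_param_bound hs
  refine Asymptotics.IsBigO.of_bound C ?_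
  filter_upwards [hC] with p hp
  simpa using hp

include hφ in
-- The Riccati equation bounds the derivatives of the `φk`, so pointwise convergence improves to
-- joint convergence. The geodesic equation does the same for velocities in `tendsto_velocity`.
theorem tendsto_param : Tendsto (fun p : ι × ℝ ↦ φk p.1 p.2) ((l : Filter ι) ×ˢ 𝓝 t)
    (𝓝 (φ t)) := by
  have hO : (fun p : ι × ℝ ↦ φk p.1 p.2 ^ 2 / 2 - 2 / ((n : ℝ) - 2) *
      ∑ a, ∑ b, ricci ((gk p.1).coord x₀) a b (coordCurve n x₀ (γk p.1) p.2) *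
        deriv (coordCurve n x₀ (γk p.1)) p.2 a * deriv (coordCurve n x₀ (γk p.1)) p.2 b)
      =O[(l : Filter ι) ×ˢ 𝓝 t] (fun _ ↦ (1 : ℝ)) := by
    have h1 := ((h.param_isBigO hs).mul (h.param_isBigO hs)).const_mul_left (1 / 2)
    have h2 := (isBigO_sum_sum (fun i j ↦ (h.tendsto_ricci hs i j).isBigO_one ℝ)
      (h.velocity_isBigO hs)).const_mul_left (2 / ((n : ℝ) - 2))
    simp only [mul_one] at h1
    refine (h1.sub h2).congr_left fun p ↦ ?_
    ring
  obtain ⟨C, hC⟩ := hO.bound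
  simp only [norm_one, mul_one] at hC
  exact tendsto_prod_nhds_of_deriv_bounded
    (f' := fun k s ↦ φk k s ^ 2 / 2 - 2 / ((n : ℝ) - 2) *
      ∑ a, ∑ b, ricci ((gk k).coord x₀) a b (coordCurve n x₀ (γk k) s) *
        deriv (coordCurve n x₀ (γk k)) s a * deriv (coordCurve n x₀ (γk k)) s b)
    ((h.hasDerivAt_family hs).mono fun p hp ↦ hp.2.2) hC (hφ t)

include hv in
theorem tendsto_velocity (i : Fin n) :
    Tendsto (fun p : ι × ℝ ↦ deriv (coordCurve n x₀ (γk p.1)) p.2 i) ((l : Filter ι) ×ˢ 𝓝 t)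
      (𝓝 (v x₀ t i)) := by
  have hO : (fun p : ι × ℝ ↦ φk p.1 p.2 * deriv (coordCurve n x₀ (γk p.1)) p.2 i -
        ∑ a, ∑ b, christoffel ((gk p.1).coord x₀) i a b (coordCurve n x₀ (γk p.1) p.2) *
          deriv (coordCurve n x₀ (γk p.1)) p.2 a * deriv (coordCurve n x₀ (γk p.1)) p.2 b)
      =O[(l : Filter ι) ×ˢ 𝓝 t] (fun _ ↦ (1 : ℝ)) := by
    have h1 := (h.param_isBigO hs).mul (h.velocity_isBigO hs i)
    have h2 := isBigO_sum_sum (fun a b ↦ (h.tendsto_christoffel hs i a b).isBigO_one ℝ)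
      (h.velocity_isBigO hs)
    simp only [mul_one] at h1
    exact h1.sub h2
  obtain ⟨C, hC⟩ := hO.bound
  simp only [norm_one, mul_one] at hC
  exact tendsto_prod_nhds_of_deriv_bounded
    (f := fun k s ↦ deriv (coordCurve n x₀ (γk k)) s i)
    (f' := fun k s ↦ φk k s * deriv (coordCurve n x₀ (γk k)) s i -
        ∑ a, ∑ b, christoffel ((gk k).coord x₀) i a b (coordCurve n x₀ (γk k) s) *
          deriv (coordCurve n x₀ (γk k)) s a * deriv (coordCurve n x₀ (γk k)) s b)
    ((h.hasDerivAt_family hs).mono fun p hp ↦ hp.2.1 i) hC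
    (((EuclideanSpace.proj (𝕜 := ℝ) i).continuous.tendsto _).comp (hv x₀ t hs))

include hv in
theorem null_limit : ∑ i, ∑ j, g.coord x₀ (coordCurve n x₀ γ t) i j * v x₀ t i * v x₀ t j = 0 := by
  have hV := h.tendsto_velocity hv hs
  have h1 := tendsto_finsetSum Finset.univ fun i _ ↦ tendsto_finsetSum Finset.univ fun j _ ↦
    ((h.tendsto_coord hs i j).mul (hV i)).mul (hV j)
  refine tendsto_nhds_unique h1 (tendsto_const_nhds.congr' ?_)
  filter_upwards [h.eventually_source hs] with p hp
  exact ((h.sol p.1).null x₀ hp.1 hp.2).symm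

variable [T2Space M] [CompactSpace M]

theorem eventually_limit_mem_source : ∀ᶠ s in 𝓝 t, γ s ∈ (extChartAt (𝓡 n) x₀).source :=
  h.continuous_limit.continuousAt.eventually ((isOpen_extChartAt_source x₀).mem_nhds hs)

include hv

theorem hasDerivAt_coordCurve_limit (i : Fin n) :
    HasDerivAt (fun s ↦ coordCurve n x₀ γ s i) (v x₀ t i) t := by
  refine hasDerivAt_of_tendsto_prod_nhds (f := fun k s ↦ coordCurve n x₀ (γk k) s i)
    (f' := fun k s ↦ deriv (coordCurve n x₀ (γk k)) s i)
    ((h.hasDerivAt_family hs).mono fun p hp ↦ hp.1 i) (h.tendsto_velocity hv hs i) ?_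
  filter_upwards [h.eventually_limit_mem_source hs] with s hs
  exact ((EuclideanSpace.proj (𝕜 := ℝ) i).continuous.tendsto _).comp
    ((continuousAt_extChartAt' hs).tendsto.comp (h.tendsto_at s))

include hφ

theorem hasDerivAt_velocity_limit (i : Fin n) :
    HasDerivAt (fun s ↦ v x₀ s i) (φ t * v x₀ t i - ∑ a, ∑ b,
      christoffel (g.coord x₀) i a b (coordCurve n x₀ γ t) * v x₀ t a * v x₀ t b) t := by
  have hV := h.tendsto_velocity hv hs
  refine hasDerivAt_of_tendsto_prod_nhds (f := fun k s ↦ deriv (coordCurve n x₀ (γk k)) s i)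
    (f' := fun k s ↦ φk k s * deriv (coordCurve n x₀ (γk k)) s i -
        ∑ a, ∑ b, christoffel ((gk k).coord x₀) i a b (coordCurve n x₀ (γk k) s) *
          deriv (coordCurve n x₀ (γk k)) s a * deriv (coordCurve n x₀ (γk k)) s b)
    ((h.hasDerivAt_family hs).mono fun p hp ↦ hp.2.1 i)
    (((h.tendsto_param hφ hs).mul (hV i)).sub
      (tendsto_finsetSum Finset.univ fun a _ ↦ tendsto_finsetSum Finset.univ fun b _ ↦
        ((h.tendsto_christoffel hs i a b).mul (hV a)).mul (hV b))) ?_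
  filter_upwards [h.eventually_limit_mem_source hs] with s hs
  exact ((EuclideanSpace.proj (𝕜 := ℝ) i).continuous.tendsto _).comp (hv x₀ s hs)

omit [T2Space M] [CompactSpace M] in
theorem hasDerivAt_param_limit :
    HasDerivAt φ (φ t ^ 2 / 2 - 2 / ((n : ℝ) - 2) * ∑ a, ∑ b,
      ricci (g.coord x₀) a b (coordCurve n x₀ γ t) * v x₀ t a * v x₀ t b) t := by
  have hV := h.tendsto_velocity hv hs
  exact hasDerivAt_of_tendsto_prod_nhds (f := φk)
    (f' := fun k s ↦ φk k s ^ 2 / 2 - 2 / ((n : ℝ) - 2) *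
      ∑ a, ∑ b, ricci ((gk k).coord x₀) a b (coordCurve n x₀ (γk k) s) *
        deriv (coordCurve n x₀ (γk k)) s a * deriv (coordCurve n x₀ (γk k)) s b)
    ((h.hasDerivAt_family hs).mono fun p hp ↦ hp.2.2)
    ((((h.tendsto_param hφ hs).pow 2).div_const 2).sub (tendsto_const_nhds.mul
      (tendsto_finsetSum Finset.univ fun a _ ↦ tendsto_finsetSum Finset.univ fun b _ ↦
        ((h.tendsto_ricci hs a b).mul (hV a)).mul (hV b)))) (Eventually.of_forall hφ)

/-- The geodesic equation as an autonomous first order system in a chart. -/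
theorem contDiffAt_limit : ContDiffAt ℝ ∞ (coordCurve n x₀ γ) t ∧ ContDiffAt ℝ ∞ φ t := by
  set U : Set ℝ := γ ⁻¹' (extChartAt (𝓡 n) x₀).source with hU
  have hUo : IsOpen U := (isOpen_extChartAt_source x₀).preimage h.continuous_limit
  -- Adjoining `φ` to position and velocity closes the system; smoothness of the limit then follows
  -- by bootstrapping.
  set X : EuclideanSpace ℝ (Fin n) × (Fin n → ℝ) × ℝ → EuclideanSpace ℝ (Fin n) × (Fin n → ℝ) × ℝ :=
    fun z ↦ (WithLp.toLp 2 z.2.1, fun i ↦ z.2.2 * z.2.1 i - ∑ a, ∑ b,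
      christoffel (g.coord x₀) i a b z.1 * z.2.1 a * z.2.1 b,
      z.2.2 ^ 2 / 2 - 2 / ((n : ℝ) - 2) * ∑ a, ∑ b,
        ricci (g.coord x₀) a b z.1 * z.2.1 a * z.2.1 b) with hX
  have hXs : ContDiffOn ℝ ∞ X (Prod.fst ⁻¹' (extChartAt (𝓡 n) x₀).target) := by
    have hvs (i : Fin n) : ContDiffOn ℝ ∞
        (fun z : EuclideanSpace ℝ (Fin n) × (Fin n → ℝ) × ℝ ↦ z.2.1 i)
        (Prod.fst ⁻¹' (extChartAt (𝓡 n) x₀).target) := by fun_prop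
    have hps : ContDiffOn ℝ ∞
        (fun z : EuclideanSpace ℝ (Fin n) × (Fin n → ℝ) × ℝ ↦ z.2.2)
        (Prod.fst ⁻¹' (extChartAt (𝓡 n) x₀).target) := by fun_prop
    have hΓ (i a b : Fin n) := ((g.smoothMetricOn_coord x₀).contDiffOn_christoffel i a b).comp
      (contDiffOn_fst (𝕜 := ℝ) (E := EuclideanSpace ℝ (Fin n)) (F := (Fin n → ℝ) × ℝ)
        (s := Prod.fst ⁻¹' (extChartAt (𝓡 n) x₀).target)) fun z hz ↦ hz
    have hR (a b : Fin n) := ((g.smoothMetricOn_coord x₀).contDiffOn_ricci a b).comp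
      (contDiffOn_fst (𝕜 := ℝ) (E := EuclideanSpace ℝ (Fin n)) (F := (Fin n → ℝ) × ℝ)
        (s := Prod.fst ⁻¹' (extChartAt (𝓡 n) x₀).target)) fun z hz ↦ hz
    refine ContDiffOn.prodMk ?_ (ContDiffOn.prodMk (contDiffOn_pi.2 fun i ↦ ?_) ?_)
    · exact contDiffOn_euclidean.2 hvs
    · exact (hps.mul (hvs i)).sub (ContDiffOn.sum fun a _ ↦ ContDiffOn.sum fun b _ ↦
        ((hΓ i a b).mul (hvs a)).mul (hvs b))
    · exact ((hps.pow 2).div_const 2).sub (contDiffOn_const.mul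
        (ContDiffOn.sum fun a _ ↦ ContDiffOn.sum fun b _ ↦ ((hR a b).mul (hvs a)).mul (hvs b)))
  have hz := contDiffOn_of_hasDerivAt_autonomous (X := X) hUo hXs
    (z := fun s ↦ (coordCurve n x₀ γ s, fun i ↦ v x₀ s i, φ s))
    (fun s hs ↦ (extChartAt (𝓡 n) x₀).map_source hs) fun s hs ↦ by
      refine HasDerivAt.prodMk ?_ (HasDerivAt.prodMk (hasDerivAt_pi.2 fun i ↦ ?_) ?_)
      · exact hasDerivAt_euclidean fun i ↦ h.hasDerivAt_coordCurve_limit hv hs i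
      · exact h.hasDerivAt_velocity_limit hv hφ hs i
      · exact h.hasDerivAt_param_limit hv hφ hs
  have hzt := hz.contDiffAt (hUo.mem_nhds hs)
  exact ⟨contDiff_fst.contDiffAt.comp t hzt,
    contDiff_snd.contDiffAt.comp t (contDiff_snd.contDiffAt.comp t hzt)⟩

end ConvergingFamily

end LimitEquation

/-! ### Rescaling, the speed bound and its consequences. -/

section Main

variable {n N : ℕ} {M : Type*} [TopologicalSpace M]
  [ChartedSpace (EuclideanSpace ℝ (Fin n)) M] [IsManifold (𝓡 n) ∞ M]

/-- The convergence of derivatives in `ℝᴺ` is included so that the normalization of the speed at `0`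
survives in the limit and excludes a constant curve. -/
theorem ConvergingFamily.exists_projGeodesicOn [T2Space M] [CompactSpace M] {ι : Type*}
    {l : Ultrafilter ι} {gk : ι → PseudoMetric n M}
    {g : PseudoMetric n M} {γk : ι → ℝ → M} {φk : ι → ℝ → ℝ} {Ik : ι → Set ℝ} {γ : ℝ → M}
    {e : M → EuclideanSpace ℝ (Fin N)} (h : ConvergingFamily l gk g γk φk Ik γ e) :
    ∃ φ, ContDiff ℝ ∞ φ ∧ ProjGeodesicOn g γ φ univ ∧
      ∀ t, Tendsto (fun k ↦ deriv (fun s ↦ e (γk k s)) t) l (𝓝 (deriv (fun s ↦ e (γ s)) t)) := by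
  obtain ⟨v, φ, hv, hφ⟩ := h.exists_limits
  have hγ : ContMDiff 𝓘(ℝ, ℝ) (𝓡 n) ∞ γ := fun t ↦ by
    rw [contMDiffAt_iff_target]
    exact ⟨h.continuous_limit.continuousAt,
      (h.contDiffAt_limit hv hφ (mem_extChartAt_source (γ t))).1.contMDiffAt⟩
  have hd {x₀ : M} {t : ℝ} (hs : γ t ∈ (extChartAt (𝓡 n) x₀).source) :
      deriv (coordCurve n x₀ γ) t = v x₀ t :=
    (hasDerivAt_euclidean fun i ↦ h.hasDerivAt_coordCurve_limit hv hs i).deriv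
  have hdd {x₀ : M} {t : ℝ} (hs : γ t ∈ (extChartAt (𝓡 n) x₀).source) (k : Fin n) :
      deriv (deriv (coordCurve n x₀ γ)) t k = φ t * v x₀ t k - ∑ a, ∑ b,
        christoffel (g.coord x₀) k a b (coordCurve n x₀ γ t) * v x₀ t a * v x₀ t b := by
    have h1 : HasDerivAt (v x₀) (WithLp.toLp 2 fun k ↦ φ t * v x₀ t k - ∑ a, ∑ b,
        christoffel (g.coord x₀) k a b (coordCurve n x₀ γ t) * v x₀ t a * v x₀ t b) t :=
      hasDerivAt_euclidean fun i ↦ h.hasDerivAt_velocity_limit hv hφ hs i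
    have h2 : deriv (coordCurve n x₀ γ) =ᶠ[𝓝 t] v x₀ := by
      filter_upwards [h.eventually_limit_mem_source hs] with s hs using hd hs
    rw [h2.deriv_eq, h1.deriv]
  refine ⟨φ, contDiff_iff_contDiffAt.2 fun t ↦
    (h.contDiffAt_limit hv hφ (mem_extChartAt_source (γ t))).2,
    ⟨hγ.contMDiffOn, fun x₀ t _ hs ↦ ?_, fun x₀ t _ hs k ↦ ?_, fun x₀ t _ hs ↦ ?_⟩, fun t ↦ ?_⟩
  · rw [hd hs]
    exact h.null_limit hv hs
  · rw [hdd hs, hd hs]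
    ring
  · rw [hd hs]
    exact h.hasDerivAt_param_limit hv hφ hs
  · have hs := mem_extChartAt_source (I := 𝓡 n) (γ t)
    have hy : coordCurve n (γ t) γ t ∈ (extChartAt (𝓡 n) (γ t)).target :=
      (extChartAt (𝓡 n) (γ t)).map_source hs
    have hopen : IsOpen (extChartAt (𝓡 n) (γ t)).target := isOpen_extChartAt_target (γ t)
    have hc : ContinuousAt (fderiv ℝ (chartMap e (γ t))) (coordCurve n (γ t) γ t) :=
      (((contDiffOn_chartMap h.smooth (γ t)).fderiv_of_isOpen (m := ∞) hopen
        (by simp)).contDiffAt (hopen.mem_nhds hy)).continuousAt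
    rw [deriv_comp_eq_fderiv_chartMap h.smooth isOpen_univ hγ.contMDiffOn (mem_univ t) hs, hd hs]
    have hslice : Tendsto (fun k ↦ (k, t)) (l : Filter ι) ((l : Filter ι) ×ˢ 𝓝 t) :=
      tendsto_id.prodMk (tendsto_const_nhds.mono_right (le_refl (𝓝 t)))
    have h1 : Tendsto (fun k ↦ fderiv ℝ (chartMap e (γ t)) (coordCurve n (γ t) (γk k) t)) l
        (𝓝 (fderiv ℝ (chartMap e (γ t)) (coordCurve n (γ t) γ t))) :=
      hc.tendsto.comp ((h.tendsto_coordCurve hs).comp hslice)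
    have h2 := (isBoundedBilinearMap_apply (𝕜 := ℝ)).continuous.tendsto
      (fderiv ℝ (chartMap e (γ t)) (coordCurve n (γ t) γ t), v (γ t) t) |>.comp
      (h1.prodMk_nhds (hv (γ t) t hs))
    refine h2.congr' ?_
    filter_upwards [hslice.eventually (h.eventually_source hs)] with k hk
    exact (deriv_comp_eq_fderiv_chartMap h.smooth (h.isOpen k) (h.sol k).contMDiffOn hk.1
      hk.2).symm

/-- Locally uniform bound on the speed of projectively parametrized lightlike geodesics
`(-1, 1) → M`. -/
def SpeedBound (e : M → EuclideanSpace ℝ (Fin N)) (g : PseudoMetric n M) (C : ℝ) : Prop :=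
  ∀ (γ : ℝ → M) (φ : ℝ → ℝ), ProjGeodesicOn g γ φ (Ioo (-1) 1) →
    ‖deriv (fun s ↦ e (γ s)) 0‖ ≤ C

omit [TopologicalSpace M] in
theorem deriv_embedding_comp_affine (e : M → EuclideanSpace ℝ (Fin N)) (γ : ℝ → M) (a b t : ℝ) :
    deriv (fun s ↦ e (γ (a + b * s))) t = b • deriv (fun s ↦ e (γ s)) (a + b * t) := by
  have h1 := deriv_comp_mul_left b (fun s ↦ e (γ (a + s))) t
  rw [deriv_comp_const_add (fun s ↦ e (γ s)) a] at h1
  exact h1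

theorem exists_rescaled_geodesic {e : M → EuclideanSpace ℝ (Fin N)}
    (he : ContMDiff (𝓡 n) (𝓡 N) ∞ e) {g : PseudoMetric n M} {γ : ℝ → M} {φ : ℝ → ℝ}
    (h : ProjGeodesicOn g γ φ (Ioo (-1) 1)) (h0 : 0 < ‖deriv (fun s ↦ e (γ s)) 0‖) :
    ∃ (γ' : ℝ → M) (φ' : ℝ → ℝ) (r : ℝ), ‖deriv (fun s ↦ e (γ s)) 0‖ / 4 ≤ r ∧
      ProjGeodesicOn g γ' φ' (Ioo (-r) r) ∧
      (∀ t ∈ Ioo (-r) r, ‖deriv (fun s ↦ e (γ' s)) t‖ ≤ 2) ∧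
      ‖deriv (fun s ↦ e (γ' s)) 0‖ = 1 := by
  -- The speed may be unbounded near `±1`, so the maximum is sought on a compact subinterval.
  have hcont : ContinuousOn (fun s ↦ ‖deriv (fun s ↦ e (γ s)) s‖) (Icc (-(1 / 2)) (1 / 2)) :=
    fun s hs ↦ (contDiffAt_deriv (contDiffAt_embedding_comp he isOpen_Ioo h.contMDiffOn
      ⟨by linarith [hs.1], by linarith [hs.2]⟩)).continuousAt.norm.continuousWithinAt
  obtain ⟨s₀, hs₀, h1, h2, h3⟩ := exists_almost_max (by norm_num) hcont h0
  set c := ‖deriv (fun s ↦ e (γ s)) s₀‖ with hc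
  have hs₀' : |s₀| < 1 / 2 := abs_lt.2 hs₀
  have hball {t : ℝ} (ht : t ∈ Ioo (-(c * (1 / 2 - |s₀|) / 2)) (c * (1 / 2 - |s₀|) / 2)) :
      |c⁻¹ * t| < (1 / 2 - |s₀|) / 2 := by
    rw [abs_mul, abs_of_pos (inv_pos.2 h2), inv_mul_lt_iff₀ h2]
    have := abs_lt.2 ht
    linarith
  -- The radius is the scale of almost maximality `(1 / 2 - |s₀|) / 2`, stretched by `c`. By `h1` it
  -- is at least a quarter of the initial speed.
  refine ⟨fun t ↦ γ (s₀ + c⁻¹ * t), fun t ↦ c⁻¹ * φ (s₀ + c⁻¹ * t), c * (1 / 2 - |s₀|) / 2, ?_,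
    h.comp_affine isOpen_Ioo (inv_ne_zero h2.ne') fun t ht ↦ ?_, fun t ht ↦ ?_, ?_⟩
  · linarith
  · have h4 := hball ht
    have h5 := abs_add_le s₀ (c⁻¹ * t)
    exact abs_lt.1 (by linarith [abs_nonneg s₀])
  · rw [deriv_embedding_comp_affine, norm_smul, Real.norm_eq_abs, abs_of_pos (inv_pos.2 h2),
      inv_mul_le_iff₀ h2]
    have := h3 (s₀ + c⁻¹ * t) (by rw [add_sub_cancel_left]; exact (hball ht).le)
    linarith
  · rw [deriv_embedding_comp_affine, mul_zero, add_zero, norm_smul, Real.norm_eq_abs,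
      abs_of_pos (inv_pos.2 h2), ← hc, inv_mul_cancel₀ h2.ne']

theorem exists_speedBound [T2Space M] [CompactSpace M] {e : M → EuclideanSpace ℝ (Fin N)}
    (he : ContMDiff (𝓡 n) (𝓡 N) ∞ e) (hemb : IsClosedEmbedding e)
    (hinj : ∀ x, Function.Injective (mfderiv (𝓡 n) (𝓡 N) e x)) {g : PseudoMetric n M}
    (hg : g.conformalClass.TotallyLightlikeIncomplete) :
    ∃ C : ℝ, 0 < C ∧ ∀ᶠ g' in 𝓝 g, SpeedBound e g' C := by
  by_contra! hcon
  -- The index set consists of all moving geodesics of all metrics, filtered by "metric tends to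
  -- `g`, speed at `0` tends to infinity". This avoids choosing sequences, hence any countability of
  -- the topology.
  set ι := {k : PseudoMetric n M × (ℝ → M) × (ℝ → ℝ) //
    ProjGeodesicOn k.1 k.2.1 k.2.2 (Ioo (-1) 1) ∧ 0 < ‖deriv (fun s ↦ e (k.2.1 s)) 0‖} with hι
  set F : ι → PseudoMetric n M × ℝ := fun k ↦ (k.1.1, ‖deriv (fun s ↦ e (k.1.2.1 s)) 0‖) with hF
  have hne : (comap F (𝓝 g ×ˢ atTop)).NeBot := by
    rw [comap_neBot_iff]
    intro t ht
    obtain ⟨U, hU, V, hV, hUV⟩ := mem_prod_iff.1 ht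
    obtain ⟨C, hC⟩ := mem_atTop_sets.1 hV
    have h1 := hcon (max C 1) (by positivity)
    obtain ⟨g', hg', hg'U⟩ := (h1.and_eventually hU).exists
    rw [SpeedBound] at hg'
    push Not at hg'
    obtain ⟨γ, φ, hγ, hlt⟩ := hg'
    exact ⟨⟨(g', γ, φ), hγ, (by positivity : (0 : ℝ) < max C 1).trans hlt⟩,
      hUV ⟨hg'U, hC _ ((le_max_left C 1).trans hlt.le)⟩⟩
  set l : Ultrafilter ι := Ultrafilter.of (comap F (𝓝 g ×ˢ atTop)) with hl
  have hlF : Tendsto F l (𝓝 g ×ˢ atTop) := tendsto_comap.mono_left (Ultrafilter.of_le _)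
  choose γk φk r hr hsol hspeed hspeed0 using
    fun k : ι ↦ exists_rescaled_geodesic he k.2.1 k.2.2
  have hrT : Tendsto r l atTop :=
    tendsto_atTop_mono hr ((tendsto_snd.comp hlF).atTop_div_const (by norm_num))
  have hmem (t : ℝ) : ∀ᶠ p : ι × ℝ in (l : Filter ι) ×ˢ 𝓝 t, p.2 ∈ Ioo (-r p.1) (r p.1) := by
    filter_upwards [(hrT.eventually_gt_atTop (|t| + 1)).prod_mk
      (Metric.ball_mem_nhds t one_pos)] with p hp
    have h1 : |p.2 - t| < 1 := hp.2
    have h2 := abs_sub_abs_le_abs_sub p.2 t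
    exact abs_lt.1 (by linarith [hp.1])
  -- Compactness of `M` gives pointwise limits; the common Lipschitz constant `2` in `ℝᴺ` makes the
  -- convergence joint in `tendsto_prod`.
  have hlim (t : ℝ) : ∃ x, Tendsto (fun k ↦ γk k t) l (𝓝 x) :=
    ⟨_, Ultrafilter.le_nhds_lim (l.map fun k ↦ γk k t)⟩
  choose γ hγ using hlim
  have hmetric : Tendsto (fun k : ι ↦ (F k).1) l (𝓝 g) := tendsto_fst.comp hlF
  have hfam : ConvergingFamily (l : Filter ι) (fun k ↦ k.1.1) g γk φk (fun k ↦ Ioo (-r k) (r k))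
      γ e :=
    { tendsto_metric := hmetric
      isOpen := fun k ↦ isOpen_Ioo
      sol := hsol
      eventually_mem := hmem
      smooth := he
      injective := hinj
      speed_le := fun k t ht ↦ hspeed k t ht
      tendsto_prod := fun t ↦ by
        rw [hemb.isInducing.tendsto_nhds_iff]
        refine tendsto_prod_nhds_of_deriv_bounded (f := fun k s ↦ e (γk k s))
          (f' := fun k s ↦ deriv (fun s ↦ e (γk k s)) s) (C := 2) ?_ ?_
          ((hemb.continuous.tendsto _).comp (hγ t))
        · filter_upwards [hmem t] with p hp
          exact ((contDiffAt_embedding_comp he isOpen_Ioo (hsol p.1).contMDiffOn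
            hp).differentiableAt (by simp)).hasDerivAt
        · filter_upwards [hmem t] with p hp using hspeed p.1 p.2 hp }
  obtain ⟨φ, hφ, hgeo, htend⟩ := hfam.exists_projGeodesicOn
  obtain ⟨x, hx⟩ := hg γ ⟨g, rfl, hgeo.isPPL_univ hφ⟩
  have h1 := (htend 0).norm
  simp only [hspeed0, hx, deriv_const, norm_zero] at h1
  exact one_ne_zero (tendsto_nhds_unique tendsto_const_nhds h1)

/-- Apply the bound to `t ↦ γ (s + b * t)`, whose speed at `0` is `b` times that of `γ` at `s`. -/
theorem SpeedBound.mul_le {e : M → EuclideanSpace ℝ (Fin N)} {g : PseudoMetric n M} {C : ℝ}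
    (hC : SpeedBound e g C) {γ : ℝ → M} {φ : ℝ → ℝ} {I : Set ℝ} (hI : IsOpen I)
    (h : ProjGeodesicOn g γ φ I) {s b : ℝ} (hb : 0 < b) (hs : ∀ t ∈ Ioo (-1) 1, s + b * t ∈ I) :
    ‖deriv (fun s ↦ e (γ s)) s‖ * b ≤ C := by
  have h1 := hC _ _ (h.comp_affine hI hb.ne' hs)
  rw [deriv_embedding_comp_affine, mul_zero, add_zero, norm_smul, Real.norm_eq_abs,
    abs_of_pos hb] at h1
  linarith

theorem exists_projGeodesicOn_of_isPPL (hn : (n : ℝ) - 2 ≠ 0) {g : PseudoMetric n M} {γ : ℝ → M}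
    {I : Set ℝ} (hI : IsOpen I) (h : g.conformalClass.IsPPL I γ) :
    ∃ φ, ProjGeodesicOn g γ φ I := by
  obtain ⟨g', hg', hγ⟩ := h
  obtain ⟨f, hf, H⟩ : g.Conformal g' := Quotient.exact hg'.symm
  obtain ⟨φ, hφ⟩ := hγ.exists_projGeodesicOn hI
  exact ⟨_, hφ.conformal hn hf H hI⟩

theorem SpeedBound.totallyLightlikeIncomplete (hn : (n : ℝ) - 2 ≠ 0)
    {e : M → EuclideanSpace ℝ (Fin N)} (he : ContMDiff (𝓡 n) (𝓡 N) ∞ e)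
    (hinj : Function.Injective e) {g : PseudoMetric n M} {C : ℝ} (hC : SpeedBound e g C) :
    g.conformalClass.TotallyLightlikeIncomplete := by
  intro γ hγ
  obtain ⟨φ, hφ⟩ := exists_projGeodesicOn_of_isPPL hn isOpen_univ hγ
  have hdiff : Differentiable ℝ fun s ↦ e (γ s) := fun t ↦
    (contDiffAt_embedding_comp he isOpen_univ hφ.contMDiffOn (mem_univ t)).differentiableAt
      (by simp)
  have hzero (s : ℝ) : deriv (fun s ↦ e (γ s)) s = 0 := by
    by_contra hs
    have hs := norm_pos_iff.2 hs
    -- On the whole line `b` is arbitrary; this choice makes the product equal to `|C| + 1 > C`.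
    have h1 := hC.mul_le isOpen_univ hφ (s := s)
      (b := (|C| + 1) / ‖deriv (fun s ↦ e (γ s)) s‖) (by positivity) fun _ _ ↦ mem_univ _
    rw [mul_div_cancel₀ _ hs.ne'] at h1
    linarith [le_abs_self C]
  exact ⟨γ 0, fun t ↦ hinj (is_const_of_deriv_eq_zero hdiff hzero t 0)⟩

theorem norm_sub_le_sum_of_chain {F : Type*} [SeminormedAddCommGroup F] :
    ∀ (m : ℕ) (a b : Fin (m + 1) → F), (∀ k : Fin m, b k.castSucc = a k.succ) →
      ‖b (Fin.last m) - a 0‖ ≤ ∑ k, ‖b k - a k‖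
  | 0, a, b, _ => by simp
  | m + 1, a, b, h => by
    rw [Fin.sum_univ_castSucc]
    have h1 := norm_sub_le_sum_of_chain m (fun k ↦ a k.castSucc) (fun k ↦ b k.castSucc)
      fun k ↦ h k.castSucc
    have h2 := norm_sub_le_norm_sub_add_norm_sub (b (Fin.last (m + 1)))
      (a (Fin.last (m + 1))) (a 0)
    have h3 : b (Fin.last m).castSucc = a (Fin.last (m + 1)) := h (Fin.last m)
    rw [← h3] at h2 ⊢
    have h4 : ‖b (Fin.last m).castSucc - a 0‖ ≤ ∑ k : Fin (m + 1), ‖b k.castSucc - a k.castSucc‖ :=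
      h1
    linarith

theorem SpeedBound.markowitzHyperbolic (hn : (n : ℝ) - 2 ≠ 0)
    {e : M → EuclideanSpace ℝ (Fin N)} (he : ContMDiff (𝓡 n) (𝓡 N) ∞ e)
    (hinj : Function.Injective e) {g : PseudoMetric n M} {C : ℝ} (hC0 : 0 < C)
    (hC : SpeedBound e g C) : g.conformalClass.MarkowitzHyperbolic := by
  intro x y hxy
  have hpos : 0 < ‖e y - e x‖ / C :=
    div_pos (norm_pos_iff.2 (sub_ne_zero.2 (hinj.ne hxy.symm))) hC0
  refine (ENNReal.ofReal_pos.2 hpos).trans_le (le_iInf fun c ↦ ENNReal.ofReal_le_ofReal ?_)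
  rw [div_le_iff₀ hC0, LightlikeChain.length, Finset.sum_mul]
  have hlen := norm_sub_le_sum_of_chain c.m (fun k ↦ e (c.γ k (c.s k)))
    (fun k ↦ e (c.γ k (c.t k))) fun k ↦ by rw [c.link k]
  rw [c.start, c.finish] at hlen
  refine hlen.trans (Finset.sum_le_sum fun k _ ↦ ?_)
  obtain ⟨φ, hφ⟩ := exists_projGeodesicOn_of_isPPL hn isOpen_Ioo (c.isPPL k)
  rw [mul_comm]
  refine norm_sub_le_poincareDist (f := fun s ↦ e (c.γ k s)) hC0.le (fun s hs ↦
    ((contDiffAt_embedding_comp he isOpen_Ioo hφ.contMDiffOn hs).differentiableAt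
      (by simp)).hasDerivAt) (fun s hs ↦ ?_) (c.s_mem k) (c.t_mem k)
  have hs' : |s| < 1 := abs_lt.2 hs
  -- `1 - |s|` is the radius of the largest interval centred at `s` inside `(-1, 1)`.
  refine hC.mul_le isOpen_Ioo hφ (sub_pos.2 hs') fun t ht ↦ abs_lt.1 ?_
  have ht' : |t| < 1 := abs_lt.2 ht
  have h1 := abs_add_le s ((1 - |s|) * t)
  rw [abs_mul, abs_of_pos (sub_pos.2 hs')] at h1
  nlinarith [sub_pos.2 hs']

end Main

end ConformalGeometry

end

open ConformalGeometry in
theorem theoremB {n : ℕ} (hn : 3 ≤ n) {M : Type*} [TopologicalSpace M]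
    [ChartedSpace (EuclideanSpace ℝ (Fin n)) M] [IsManifold (𝓡 n) ∞ M]
    [T2Space M] [CompactSpace M]
    (c : ConformalClass n M) (hc : c.TotallyLightlikeIncomplete) :
    (∃ W ∈ 𝓝 c, ∀ c' ∈ W, c'.MarkowitzHyperbolic) ∧ c.MarkowitzHyperbolic := by
  have hn' : (n : ℝ) - 2 ≠ 0 := by
    have : (3 : ℝ) ≤ n := by exact_mod_cast hn
    linarith
  obtain ⟨N, e, he, hemb, hinj⟩ := exists_embedding_euclidean_of_compact (I := 𝓡 n) (M := M)
  have hyp (c' : ConformalClass n M) (h : c'.TotallyLightlikeIncomplete) :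
      c'.MarkowitzHyperbolic := by
    induction c' using Quotient.inductionOn with | _ g => ?_
    obtain ⟨C, hC0, hC⟩ := exists_speedBound he hemb hinj h
    exact hC.self_of_nhds.markowitzHyperbolic hn' he hemb.injective hC0
  -- The neighbourhood is the set of all incomplete classes. Its openness in the quotient is tested
  -- on metrics, where a speed bound valid near `g` gives incompleteness near `g`.
  refine ⟨⟨{c' | c'.TotallyLightlikeIncomplete}, IsOpen.mem_nhds ?_ hc, hyp⟩, hyp c hc⟩
  refine isOpen_coinduced.2 (isOpen_iff_mem_nhds.2 fun g hg ↦ ?_)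
  obtain ⟨C, -, hC⟩ := exists_speedBound (g := g) he hemb hinj hg
  filter_upwards [hC] with g' hg'
  exact hg'.totallyLightlikeIncomplete hn' he hemb.injective
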